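/- **Theorem.** The Scherer–Lea–Scott synchronous queue is linearizable with respect to the sequential first-in-first-out queue. *The object.* Nodes have an item (a value or null), an immutable type (item or reservation) and a next pointer; memory is never reused. The shared variables head and tail initially point to one dummy node (null item, type "item", null next). Every thread performs at most one invocation, enq$(e)$ with $e\neq$ null, or deq$()$; any number of threads interleave, each read, test or compare-and-set (CAS) being one atomic step. - enq$(e)$ allocates offer $=$ (item $e$, type "item", next null) and repeats: $t:=$ tail; $h:=$ head. - If $h=t$ or $t$.type is "item": $n:=t$.next; if tail $\ne t$, restart; if $n\neq$ null, CAS(tail, $t$, $n$) and restart; otherwise CAS($t$.next, $n$, offer), restarting on failure. On success: CAS(tail, $t$, offer); wait until offer.item $\neq e$; $h:=$ head; if offer $=h$.next then CAS(head, $h$, offer); return. - Otherwise: $n:=h$.next; restart if tail $\neq t$ or head $\neq h$ or $n=$ null; perform CAS($n$.item, null, $e$), then CAS(head, $h$, $n$); return if the first CAS succeeded, else restart. - deq$()$ is dual. It allocates offer $=$ (item null, type "reservation", next null). It takes the first branch if $h=t$ or $t$.type is "reservation", waits there until offer.item $\neq$ null, and finally returns offer.item. In the second branch it reads $x:=n$.item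 and, if $x\ne$ null, performs CAS($n$.item, $x$, null); then, in every case, CAS(head, $h$, $n$); it returns $x$ if its CAS on $n$.item succeeded and restarts otherwise. *Linearizability.* For the trace $\tau$ of every finite execution (completed or not) there are an order on a set of invoked operations containing all those that returned, returned values for those among them that have not returned, and positions of $\tau$ (linearization points, possibly shared, non-decreasing along the order), each strictly between the invocation of the operation and its return (if any), such that the resulting sequence of operations is a legal run of the FIFO queue from the empty queue (a dequeue returns the oldest element; there is no dequeue from the empty queue). *Form of the linearization.* Name the successful CAS steps as follows: $\mathit{Eapp}$, $\mathit{Dapp}$ (on $t$.next, by an enqueue or a dequeue), $\mathit{TA}$ (on tail), $\mathit{Eswap}$, $\mathit{Dswap}$ (on $n$.item, by an enqueue or a dequeue), $\mathit{HR}$ (on head). Every finite execution $\tau$ can be extended by at most two further steps (by none if all invoked operations have returned in $\tau$) to an execution $\tau'$ such that the sequence of successful CAS steps of $\tau'$ can be rearranged into a word $w$ of $$\big([\mathit{Dapp}\cdot \mathit{TA}\cdot(\mathit{Eswap}\cdot \mathit{HR}\cdot \mathit{Dapp}\cdot \mathit{TA})^*\cdot \mathit{Eswap}\cdot \mathit{HR}]+[\mathit{Eapp}\cdot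 \mathit{TA}\cdot(\mathit{Dswap}\cdot \mathit{HR}\cdot \mathit{Eapp}\cdot \mathit{TA})^*\cdot \mathit{Dswap}\cdot \mathit{HR}]\big)^*\cdot\big([\mathit{Dapp}\cdot \mathit{TA}]^*+[\mathit{Eapp}\cdot \mathit{TA}]^*\big),$$ where the only rearrangement allowed is, repeatedly, to move an $\mathit{Eswap}$, $\mathit{Dswap}$ or $\mathit{HR}$ ahead of an immediately preceding $\mathit{Eapp}$, $\mathit{Dapp}$ or $\mathit{TA}$ of a different thread. Moreover, $\tau'$ has a linearization as above (a legal run of the FIFO queue) whose sequence of enqueues ($E$) and dequeues ($D$) is the projection of $w$ under $\mathit{Eapp}\mapsto E$, $\mathit{Eswap}\mapsto E\cdot D$, $\mathit{Dswap}\mapsto D$, all other letters being erased. This projection maps every word of the expression into $(E\cdot D)^*\cdot(E^*+D^*)$. -/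

import Mathlib

/-! ### Concurrent objects: code, executions, traces -/

/-- Kleene-algebra-with-tests code over primitive actions `A` and primitive tests `B`.
`ntest b` is the negation of the test `b`; `arw b a` is the atomic read-write that tests `b` and,
without any interleaving, performs `a`; `ret` returns from the method. -/
inductive Kat (A B : Type*) where
  | one : Kat A B
  | act : A → Kat A B
  | test : B → Kat A B
  | ntest : B → Kat A B
  | arw : B → A → Kat A B
  | ret : Kat A B
  | seq : Kat A B → Kat A B → Kat A B
  | plus : Kat A B → Kat A B → Kat A B
  | star : Kat A B → Kat A B

infixr:70 " ⨟ " => Kat.seq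
infixr:65 " ⊞ " => Kat.plus

/-- Labels of an execution: invocations (a method with its arguments), primitive actions, tests
(with their outcome), successful atomic read-writes, and returns (with the returned value). -/
inductive Label (I R A B : Type*) where
  | inv : I → Label I R A B
  | act : A → Label I R A B
  | test : B → Bool → Label I R A B
  | arw : B → A → Label I R A B
  | ret : R → Label I R A B

/-- A concurrent object. `I` is the type of invocations (method and arguments), `R` of returned
values, `L` of local states, `G` of shared states. -/
structure ConcObject (I R L G A B : Type*) where
  code : I → Kat A B
  localInit : I → L
  sharedInit : G
  actSem : A → L → G → L × G
  testSem : B → L → G → Prop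
  retVal : L → R

namespace Kat

variable {A B : Type*}

/-- The code can terminate without performing any labelled step. -/
inductive Nullable : Kat A B → Prop
  | one : Nullable one
  | seq {k k'} : Nullable k → Nullable k' → Nullable (seq k k')
  | plusL {k k'} : Nullable k → Nullable (plus k k')
  | plusR {k k'} : Nullable k' → Nullable (plus k k')
  | star {k} : Nullable (star k)

end Kat

/-- One labelled step of a single thread, all label-free nondeterminism (choices, loop unfoldings)
before the label being resolved. The code `none` means that the thread has returned. -/
inductive ConcObject.ThreadStep {I R L G A B : Type*} (O : ConcObject I R L G A B)
    (l : L) (g : G) : Kat A B → Label I R A B → L → G → Option (Kat A B) → Prop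
  | act (a : A) :
      ThreadStep O l g (.act a) (.act a) (O.actSem a l g).1 (O.actSem a l g).2 (some .one)
  | test (b : B) (h : O.testSem b l g) :
      ThreadStep O l g (.test b) (.test b true) l g (some .one)
  | ntest (b : B) (h : ¬ O.testSem b l g) :
      ThreadStep O l g (.ntest b) (.test b false) l g (some .one)
  | arw (b : B) (a : A) (h : O.testSem b l g) :
      ThreadStep O l g (.arw b a) (.arw b a) (O.actSem a l g).1 (O.actSem a l g).2 (some .one)
  | ret : ThreadStep O l g .ret (.ret (O.retVal l)) l g none
  | plusL {k k' : Kat A B} {ℓ l' g' r} :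
      ThreadStep O l g k ℓ l' g' r → ThreadStep O l g (.plus k k') ℓ l' g' r
  | plusR {k k' : Kat A B} {ℓ l' g' r} :
      ThreadStep O l g k' ℓ l' g' r → ThreadStep O l g (.plus k k') ℓ l' g' r
  | seqL {k k' : Kat A B} {ℓ l' g' r} :
      ThreadStep O l g k ℓ l' g' r →
        ThreadStep O l g (.seq k k') ℓ l' g' (r.map fun k₁ => .seq k₁ k')
  | seqR {k k' : Kat A B} {ℓ l' g' r} :
      k.Nullable → ThreadStep O l g k' ℓ l' g' r → ThreadStep O l g (.seq k k') ℓ l' g' r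
  | star {k : Kat A B} {ℓ l' g' r} :
      ThreadStep O l g k ℓ l' g' r →
        ThreadStep O l g (.star k) ℓ l' g' (r.map fun k₁ => .seq k₁ (.star k))

/-- A configuration: the shared state, and for every thread that has been invoked its local state
and remaining code (`none` for the code once it has returned). -/
structure Config (T L G A B : Type*) where
  shared : G
  thread : T → Option (L × Option (Kat A B))

/-- Every invoked thread has returned. -/
def Config.Final {T L G A B : Type*} (C : Config T L G A B) : Prop :=
  ∀ t l k, C.thread t = some (l, k) → k = none

namespace ConcObject

variable {I R L G A B T : Type*} [DecidableEq T]

/-- `O.Exec env τ C`: `τ` is the trace of an execution of `O` that starts in the initial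
configuration and ends in `C`. The environment `env` says which threads may perform an invocation,
and which one; every thread performs at most one. -/
inductive Exec (O : ConcObject I R L G A B) (env : T → Option I) :
    List (T × Label I R A B) → Config T L G A B → Prop
  | init : Exec O env [] ⟨O.sharedInit, fun _ => none⟩
  | inv {τ C} (t : T) (i : I) : Exec O env τ C → env t = some i → C.thread t = none →
      Exec O env (τ ++ [(t, .inv i)])
        ⟨C.shared, Function.update C.thread t (some (O.localInit i, some (O.code i)))⟩
  | step {τ C} (t : T) {l l' : L} {k : Kat A B} {ℓ : Label I R A B} {g' : G}
      {r : Option (Kat A B)} : Exec O env τ C → C.thread t = some (l, some k) →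
      O.ThreadStep l C.shared k ℓ l' g' r →
      Exec O env (τ ++ [(t, ℓ)]) ⟨g', Function.update C.thread t (some (l', r))⟩

end ConcObject

/-! ### Linearizability -/

/-- `s` lists threads with their operation symbols (invocation and returned value), in the order of
linearization points. Every operation that returned in `τ` is listed; operations that were invoked
but have not returned may be listed, with a suitable returned value. The linearization point
`lp t` is a position of the trace after the invocation and before the return (if any) of `t`; one
position may serve as the linearization point of several threads. -/
structure IsLinearization {I R A B T : Type*} (S : Set (List (I × R)))
    (τ : List (T × Label I R A B)) (s : List (T × I × R)) : Prop where
  nodup : (s.map Prod.fst).Nodup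
  returned : ∀ t r, (t, Label.ret r) ∈ τ → ∃ i, (t, i, r) ∈ s
  invoked : ∀ t i r, (t, i, r) ∈ s → (t, Label.inv i) ∈ τ
  points : ∃ lp : T → ℕ,
    (∀ x ∈ s, lp x.1 < τ.length ∧
      (∀ j i, τ[j]? = some (x.1, Label.inv i) → j < lp x.1) ∧
      (∀ j r, τ[j]? = some (x.1, Label.ret r) → lp x.1 < j)) ∧
    s.Pairwise fun x y => lp x.1 ≤ lp y.1
  spec : s.map Prod.snd ∈ S

/-- All traces of executions of `O` (completed or not), by any set of threads of the type `T`, are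
linearizable with respect to `S`. -/
def ConcObject.Linearizable {I R L G A B : Type*} (O : ConcObject I R L G A B)
    (S : Set (List (I × R))) (T : Type*) [DecidableEq T] : Prop :=
  ∀ (env : T → Option I) τ C, O.Exec env τ C → ∃ s, IsLinearization S τ s

/-! ### The sequential queue -/

inductive QInv (V : Type*) where
  | enq : V → QInv V
  | deq : QInv V

/-- `QueueRun q w`: from the queue content `q` (oldest element first), the sequence `w` of
operations is a legal run of a first-in-first-out queue. An enqueue returns nothing. -/
inductive QueueRun {V : Type*} : List V → List (QInv V × Option V) → Prop
  | nil (q : List V) : QueueRun q []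
  | enq {q : List V} {w} (v : V) : QueueRun (q ++ [v]) w → QueueRun q ((.enq v, none) :: w)
  | deq {q : List V} {w} (v : V) : QueueRun q w → QueueRun (v :: q) ((.deq, some v) :: w)

def queueSpec (V : Type*) : Set (List (QInv V × Option V)) := {w | QueueRun [] w}

/-! ### The synchronous reservation queue of Scherer, Lea and Scott -/

namespace SLS

inductive NodeType where
  | item
  | reservation

/-- A node; `item = none` is the null value, `next = none` the null pointer. -/
structure Node (V : Type*) where
  item : Option V
  type : NodeType
  next : Option ℕ

/-- The shared memory. Addresses are numbers, those below `size` are allocated, and memory is never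
reused. -/
structure Shared (V : Type*) where
  head : ℕ
  tail : ℕ
  size : ℕ
  node : ℕ → Node V

/-- The local variables: the argument (null for a dequeue), the own node, the node variables
`t`, `h`, `n`, and the value `x` that a dequeue returns. -/
structure Loc (V : Type*) where
  arg : Option V
  offer : ℕ
  t : ℕ
  h : ℕ
  n : Option ℕ
  x : Option V

inductive Act where
  | newOffer (ty : NodeType) -- offer := new Node(arg, ty)
  | readTail                 -- t := tail
  | readHead                 -- h := head
  | readTNext                -- n := t.next
  | readHNext                -- n := h.next
  | readNItem                -- x := n.item
  | readOfferItem            -- x := offer.item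
  | linkOffer                -- t.next := offer
  | tailToN                  -- tail := n
  | tailToOffer              -- tail := offer
  | headToN                  -- head := n
  | headToOffer              -- head := offer
  | putArg                   -- n.item := arg
  | putNull                  -- n.item := null

inductive Tst where
  | hIsT                     -- h = t
  | tType (ty : NodeType)    -- t.type = ty
  | tailIsT                  -- tail = t
  | headIsH                  -- head = h
  | nIsNull                  -- n = null
  | tNextIsN                 -- t.next = n
  | offerItemIsArg           -- offer.item = arg
  | offerIsHNext             -- offer = h.next
  | nItemIsNull              -- n.item = null
  | nItemIsX                 -- n.item = x
  | xIsNull                  -- x = null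

variable {V : Type*}

def Shared.setNode (g : Shared V) (p : ℕ) (v : Node V) : Shared V :=
  { g with node := Function.update g.node p v }

/-- The address in a pointer; it is only used for pointers that were tested not to be null. -/
def addr (p : Option ℕ) : ℕ := p.getD 0

def actSem : Act → Loc V → Shared V → Loc V × Shared V
  | .newOffer ty, l, g =>
      ({ l with offer := g.size }, { g.setNode g.size ⟨l.arg, ty, none⟩ with size := g.size + 1 })
  | .readTail, l, g => ({ l with t := g.tail }, g)
  | .readHead, l, g => ({ l with h := g.head }, g)
  | .readTNext, l, g => ({ l with n := (g.node l.t).next }, g)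
  | .readHNext, l, g => ({ l with n := (g.node l.h).next }, g)
  | .readNItem, l, g => ({ l with x := (g.node (addr l.n)).item }, g)
  | .readOfferItem, l, g => ({ l with x := (g.node l.offer).item }, g)
  | .linkOffer, l, g => (l, g.setNode l.t { g.node l.t with next := some l.offer })
  | .tailToN, l, g => (l, { g with tail := addr l.n })
  | .tailToOffer, l, g => (l, { g with tail := l.offer })
  | .headToN, l, g => (l, { g with head := addr l.n })
  | .headToOffer, l, g => (l, { g with head := l.offer })
  | .putArg, l, g => (l, g.setNode (addr l.n) { g.node (addr l.n) with item := l.arg })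
  | .putNull, l, g => (l, g.setNode (addr l.n) { g.node (addr l.n) with item := none })

def testSem : Tst → Loc V → Shared V → Prop
  | .hIsT, l, _ => l.h = l.t
  | .tType ty, l, g => (g.node l.t).type = ty
  | .tailIsT, l, g => g.tail = l.t
  | .headIsH, l, g => g.head = l.h
  | .nIsNull, l, _ => l.n = none
  | .tNextIsN, l, g => (g.node l.t).next = l.n
  | .offerItemIsArg, l, g => (g.node l.offer).item = l.arg
  | .offerIsHNext, l, g => (g.node l.h).next = some l.offer
  | .nItemIsNull, l, g => (g.node (addr l.n)).item = none
  | .nItemIsX, l, g => (g.node (addr l.n)).item = l.x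
  | .xIsNull, l, _ => l.x = none

open Kat in
/-- A compare-and-set whose result is ignored. -/
def cas (b : Tst) (a : Act) : Kat Act Tst := arw b a ⊞ ntest b

open Kat in
/-- The branch that appends the own node to the list and waits until its item has been changed;
`fin` is the end of the method. -/
def appendBranch (fin : Kat Act Tst) : Kat Act Tst :=
  act .readTNext ⨟
    (ntest .tailIsT ⊞
      test .tailIsT ⨟
        (ntest .nIsNull ⨟ cas .tailIsT .tailToN ⊞
          test .nIsNull ⨟
            (ntest .tNextIsN ⊞
              arw .tNextIsN .linkOffer ⨟ cas .tailIsT .tailToOffer ⨟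
                star (test .offerItemIsArg) ⨟ ntest .offerItemIsArg ⨟
                act .readHead ⨟
                (ntest .offerIsHNext ⊞ test .offerIsHNext ⨟ cas .headIsH .headToOffer) ⨟ fin)))

open Kat in
/-- The branch that works on the successor of the head node; `swap` is the attempt to exchange the
item of that node, once it is known to exist. -/
def swapBranch (swap : Kat Act Tst) : Kat Act Tst :=
  act .readHNext ⨟
    (ntest .tailIsT ⊞
      test .tailIsT ⨟ (ntest .headIsH ⊞ test .headIsH ⨟ (test .nIsNull ⊞ ntest .nIsNull ⨟ swap)))

open Kat in
/-- A method: allocate a node of type `ty`; then repeatedly read the tail and the head and take the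
append branch if the list is empty or consists of nodes of type `ty`, else the swap branch. -/
def method (ty : NodeType) (fin swap : Kat Act Tst) : Kat Act Tst :=
  act (.newOffer ty) ⨟
    star (act .readTail ⨟ act .readHead ⨟
      ((test .hIsT ⊞ ntest .hIsT ⨟ test (.tType ty)) ⨟ appendBranch fin ⊞
        ntest .hIsT ⨟ ntest (.tType ty) ⨟ swapBranch swap))

open Kat in
def enqCode : Kat Act Tst :=
  method .item ret
    (arw .nItemIsNull .putArg ⨟ cas .headIsH .headToN ⨟ ret ⊞
      ntest .nItemIsNull ⨟ cas .headIsH .headToN)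

open Kat in
def deqCode : Kat Act Tst :=
  method .reservation (act .readOfferItem ⨟ ret)
    (act .readNItem ⨟
      (test .xIsNull ⨟ cas .headIsH .headToN ⊞
        ntest .xIsNull ⨟
          (arw .nItemIsX .putNull ⨟ cas .headIsH .headToN ⨟ ret ⊞
            ntest .nItemIsX ⨟ cas .headIsH .headToN)))

/-- The synchronous queue with elements in `V`: initially the list consists of a dummy node, to
which both `head` and `tail` point. An enqueue returns no value (its variable `x` stays null). -/
def queue (V : Type*) : ConcObject (QInv V) (Option V) (Loc V) (Shared V) Act Tst where
  code
    | .enq _ => enqCode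
    | .deq => deqCode
  localInit
    | .enq v => ⟨some v, 0, 0, 0, none, none⟩
    | .deq => ⟨none, 0, 0, 0, none, none⟩
  sharedInit := ⟨0, 0, 1, fun _ => ⟨none, .item, none⟩⟩
  actSem := actSem
  testSem := testSem
  retVal l := l.x

/-! ### Layers and their linearization points -/

/-- The kinds of layers, each named by its shared-memory write: appending the node of an enqueue
or dequeue, exchanging an item by an enqueue or dequeue, advancing the tail, advancing the head. -/
inductive Layer where
  | Eapp
  | Dapp
  | Eswap
  | Dswap
  | TA
  | HR

/-- The layer that a label of a thread executing a given invocation writes for, if any. -/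
def layerOf : QInv V → Label (QInv V) (Option V) Act Tst → Option Layer
  | .enq _, .arw _ .linkOffer => some .Eapp
  | .deq, .arw _ .linkOffer => some .Dapp
  | _, .arw _ .putArg => some .Eswap
  | _, .arw _ .putNull => some .Dswap
  | _, .arw _ .tailToN => some .TA
  | _, .arw _ .tailToOffer => some .TA
  | _, .arw _ .headToN => some .HR
  | _, .arw _ .headToOffer => some .HR
  | _, _ => none

/-- The sequence of writes of a trace, each with its thread. -/
def writes {T : Type*} (env : T → Option (QInv V))
    (τ : List (T × Label (QInv V) (Option V) Act Tst)) : List (T × Layer) :=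
  τ.filterMap fun x => (env x.1).bind fun i => (layerOf i x.2).map fun y => (x.1, y)

/-- Writes to `next` fields and to `tail`. -/
def Layer.TailSide : Layer → Prop
  | .Eapp | .Dapp | .TA => True
  | _ => False

/-- Writes to `item` fields and to `head`. -/
def Layer.HeadSide : Layer → Prop
  | .Eswap | .Dswap | .HR => True
  | _ => False

/-- Exchange of two adjacent writes of different threads (to disjoint parts of the memory): a write
on the head side moves ahead of a write on the tail side. -/
inductive Exchange {T : Type*} : List (T × Layer) → List (T × Layer) → Prop
  | mk (u v : List (T × Layer)) (x y : T × Layer) : x.1 ≠ y.1 → x.2.TailSide → y.2.HeadSide →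
      Exchange (u ++ x :: y :: v) (u ++ y :: x :: v)

open RegularExpression (char) in
/-- `([Dapp·TA·(Eswap·HR·Dapp·TA)*·Eswap·HR] + [Eapp·TA·(Dswap·HR·Eapp·TA)*·Dswap·HR])*
· ([Dapp·TA]* + [Eapp·TA]*)` -/
def layerExpr : RegularExpression Layer :=
  .star
    (char .Dapp * char .TA * .star (char .Eswap * char .HR * char .Dapp * char .TA) *
        char .Eswap * char .HR +
      char .Eapp * char .TA * .star (char .Dswap * char .HR * char .Eapp * char .TA) *
        char .Dswap * char .HR) *
  (.star (char .Dapp * char .TA) + .star (char .Eapp * char .TA))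

inductive ED where
  | E
  | D

def kind : QInv V → ED
  | .enq _ => .E
  | .deq => .D

/-- The linearization points marked in the layers. -/
def marks : Layer → List ED
  | .Eapp => [.E]
  | .Eswap => [.E, .D]
  | .Dswap => [.D]
  | _ => []

open RegularExpression (char) in
/-- `(E·D)*·(E* + D*)` -/
def pointExpr : RegularExpression ED :=
  .star (char .E * char .D) * (.star (char .E) + .star (char .D))

end SLS

/-! Nodes are only appended and addresses are never reused, so an execution determines the list `a
0, …, a m` of all nodes ever in the queue, and counters describe the shared state: `tail` is `a tl`,
`head` is `a hd`, and the items of the first `sw` appended nodes have been exchanged, with `hd ≤ sw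
≤ hd + 1`, `sw ≤ tl` and `tl ≤ m ≤ tl + 1`. An operation appends only if the last node has its own
type or is not beyond the head, so all nodes beyond the head have one type. An operation exchanges
an item only at the successor of the head and only against the opposite type, so items are exchanged
in list order.

Node `a (k + 1)` is thus the meeting place of its appender and at most one exchanger. Everything
that concerns it is collected in block `k`: the writes `W k` and the linearized operations `S k`.
For `k < sw` these operations are an enqueue and the dequeue of the same value, both linearized at
the exchange. For `k ≥ sw` they are a lone enqueue, linearized at the end of the trace, or nothing
if the node is a reservation. The blocks in order are a run of the queue: pairs on the empty queue,
then only enqueues (`Inv.isLinearization`).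

The blocks also give the word `w`. An append opens a new last block and an advance of the tail
concerns the last block. Exchanges and advances of the head belong to a block after which only
tail-side writes occur, and none of those is by the same thread (`Inv.later_writes`), so the allowed
exchanges bring them into place (`exchanges_insert`). At most one advance of the tail and one
advance of the head are pending, and for each a definite thread is ready to perform it
(`Inv.exists_linked`, `Inv.exists_swapped`). After these at most two steps the word has the required
form (`flatMap_letters_mem_layerExpr`).

All this is the invariant `Inv`, proved in the manner of Owicki and Gries. `move_of_threadStep`
replaces code by program counters, and each of these carries an assertion `At`. `Reads.at` is local
correctness of reading steps, `At.ext` is freedom from interference, and `Inv.tailStep`,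
`Inv.headStep`, `Inv.swapStep` and `Inv.linkStep` treat the four kinds of writes. -/

/-! ### Steps of a single thread -/

namespace ConcObject

variable {I R L G A B : Type*} {O : ConcObject I R L G A B} {l l' : L} {g g' : G}
  {k k' : Kat A B} {ℓ : Label I R A B} {r : Option (Kat A B)} {a : A} {b : B}

theorem threadStep_one : O.ThreadStep l g .one ℓ l' g' r ↔ False :=
  ⟨fun h => (nomatch h), False.elim⟩

theorem threadStep_act : O.ThreadStep l g (.act a) ℓ l' g' r ↔
    ℓ = .act a ∧ l' = (O.actSem a l g).1 ∧ g' = (O.actSem a l g).2 ∧ r = some .one := by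
  constructor
  · rintro ⟨⟩; exact ⟨rfl, rfl, rfl, rfl⟩
  · rintro ⟨rfl, rfl, rfl, rfl⟩; exact .act a

theorem threadStep_test : O.ThreadStep l g (.test b) ℓ l' g' r ↔
    O.testSem b l g ∧ ℓ = .test b true ∧ l' = l ∧ g' = g ∧ r = some .one := by
  constructor
  · rintro ⟨⟩; exact ⟨‹_›, rfl, rfl, rfl, rfl⟩
  · rintro ⟨h, rfl, rfl, rfl, rfl⟩; exact .test b h

theorem threadStep_ntest : O.ThreadStep l g (.ntest b) ℓ l' g' r ↔
    ¬ O.testSem b l g ∧ ℓ = .test b false ∧ l' = l ∧ g' = g ∧ r = some .one := by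
  constructor
  · rintro ⟨⟩; exact ⟨‹_›, rfl, rfl, rfl, rfl⟩
  · rintro ⟨h, rfl, rfl, rfl, rfl⟩; exact .ntest b h

theorem threadStep_arw : O.ThreadStep l g (.arw b a) ℓ l' g' r ↔
    O.testSem b l g ∧ ℓ = .arw b a ∧ l' = (O.actSem a l g).1 ∧ g' = (O.actSem a l g).2 ∧
      r = some .one := by
  constructor
  · rintro ⟨⟩; exact ⟨‹_›, rfl, rfl, rfl, rfl⟩
  · rintro ⟨h, rfl, rfl, rfl, rfl⟩; exact .arw b a h

theorem threadStep_ret : O.ThreadStep l g .ret ℓ l' g' r ↔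
    ℓ = .ret (O.retVal l) ∧ l' = l ∧ g' = g ∧ r = none := by
  constructor
  · rintro ⟨⟩; exact ⟨rfl, rfl, rfl, rfl⟩
  · rintro ⟨rfl, rfl, rfl, rfl⟩; exact .ret

theorem threadStep_plus : O.ThreadStep l g (.plus k k') ℓ l' g' r ↔
    O.ThreadStep l g k ℓ l' g' r ∨ O.ThreadStep l g k' ℓ l' g' r := by
  constructor
  · rintro (_ | _ | _ | _ | _ | h | h)
    exacts [.inl h, .inr h]
  · rintro (h | h)
    exacts [.plusL h, .plusR h]

theorem threadStep_seq : O.ThreadStep l g (.seq k k') ℓ l' g' r ↔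
    (∃ r₀, O.ThreadStep l g k ℓ l' g' r₀ ∧ r = r₀.map fun k₁ => .seq k₁ k') ∨
      k.Nullable ∧ O.ThreadStep l g k' ℓ l' g' r := by
  constructor
  · intro h
    cases h with
    | seqL h => exact .inl ⟨_, h, rfl⟩
    | seqR hn h => exact .inr ⟨hn, h⟩
  · rintro (⟨_, h, rfl⟩ | ⟨hn, h⟩)
    exacts [.seqL h, .seqR hn h]

theorem threadStep_star : O.ThreadStep l g (.star k) ℓ l' g' r ↔
    ∃ r₀, O.ThreadStep l g k ℓ l' g' r₀ ∧ r = r₀.map fun k₁ => .seq k₁ (.star k) := by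
  constructor
  · intro h
    cases h with
    | star h => exact ⟨_, h, rfl⟩
  · rintro ⟨_, h, rfl⟩
    exact .star h

end ConcObject

namespace Kat

variable {A B : Type*} {k k' : Kat A B} {a : A} {b : B}

theorem nullable_one : (one : Kat A B).Nullable ↔ True := ⟨fun _ => trivial, fun _ => .one⟩
theorem nullable_star : (star k).Nullable ↔ True := ⟨fun _ => trivial, fun _ => .star⟩
theorem nullable_act : (act a : Kat A B).Nullable ↔ False := ⟨fun h => (nomatch h), False.elim⟩
theorem nullable_test : (test b : Kat A B).Nullable ↔ False := ⟨fun h => (nomatch h), False.elim⟩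
theorem nullable_ntest : (ntest b : Kat A B).Nullable ↔ False := ⟨fun h => (nomatch h), False.elim⟩
theorem nullable_arw : (arw b a).Nullable ↔ False := ⟨fun h => (nomatch h), False.elim⟩
theorem nullable_ret : (ret : Kat A B).Nullable ↔ False := ⟨fun h => (nomatch h), False.elim⟩

theorem nullable_seq : (k ⨟ k').Nullable ↔ k.Nullable ∧ k'.Nullable := by
  constructor
  · rintro ⟨⟩; exact ⟨‹_›, ‹_›⟩
  · rintro ⟨h, h'⟩; exact .seq h h'

theorem nullable_plus : (k ⊞ k').Nullable ↔ k.Nullable ∨ k'.Nullable := by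
  constructor
  · intro h
    cases h with
    | plusL h => exact .inl h
    | plusR h => exact .inr h
  · rintro (h | h)
    exacts [.plusL h, .plusR h]

end Kat

namespace SLS

variable {V T : Type*}

/-! ### Program counters -/

/-- The type of the node that an operation allocates. -/
def tyOf : QInv V → NodeType
  | .enq _ => .item
  | .deq => .reservation

/-- The initial item of the node that an operation allocates. -/
def argOf : QInv V → Option V
  | .enq v => some v
  | .deq => none

open Kat in
/-- The end of the append branch of an operation. -/
def finOf : QInv V → Kat Act Tst
  | .enq _ => ret
  | .deq => act .readOfferItem ⨟ ret

open Kat in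
/-- The item exchange of an operation. -/
def swapOf : QInv V → Kat Act Tst
  | .enq _ => arw .nItemIsNull .putArg ⨟ cas .headIsH .headToN ⨟ ret ⊞
      ntest .nItemIsNull ⨟ cas .headIsH .headToN
  | .deq => act .readNItem ⨟
      (test .xIsNull ⨟ cas .headIsH .headToN ⊞
        ntest .xIsNull ⨟
          (arw .nItemIsX .putNull ⨟ cas .headIsH .headToN ⨟ ret ⊞
            ntest .nItemIsX ⨟ cas .headIsH .headToN))

theorem queue_code (i : QInv V) :
    (queue V).code i = method (tyOf i) (finOf i) (swapOf i) := by
  cases i <;> rfl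

/-- The points that a thread can reach in its code. -/
inductive PC where
  | start | loop | gotTail | gotHead | differ | differ'
  | append | appendNext | appendChecked | tailCas | linkCas | linked
  | wait | waiting | woken | wokenHead | headCas | finish
  | swap | swapNext | swapTail | swapHead | swapReady | swapItem | swapCas | swapped | missed
  | atRet | returned

open Kat in
/-- The part of the loop body that is still to be executed; `returned` has none. -/
def PC.body (i : QInv V) : PC → Kat Act Tst
  | start => act (.newOffer (tyOf i))
  | loop => one
  | gotTail => one ⨟ act .readHead ⨟
      ((test .hIsT ⊞ ntest .hIsT ⨟ test (.tType (tyOf i))) ⨟ appendBranch (finOf i) ⊞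
        ntest .hIsT ⨟ ntest (.tType (tyOf i)) ⨟ swapBranch (swapOf i))
  | gotHead => one ⨟
      ((test .hIsT ⊞ ntest .hIsT ⨟ test (.tType (tyOf i))) ⨟ appendBranch (finOf i) ⊞
        ntest .hIsT ⨟ ntest (.tType (tyOf i)) ⨟ swapBranch (swapOf i))
  | differ => (one ⨟ test (.tType (tyOf i))) ⨟ appendBranch (finOf i)
  | differ' => one ⨟ ntest (.tType (tyOf i)) ⨟ swapBranch (swapOf i)
  | append => one ⨟ appendBranch (finOf i)
  | appendNext => one ⨟ (ntest .tailIsT ⊞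
      test .tailIsT ⨟
        (ntest .nIsNull ⨟ cas .tailIsT .tailToN ⊞
          test .nIsNull ⨟
            (ntest .tNextIsN ⊞
              arw .tNextIsN .linkOffer ⨟ cas .tailIsT .tailToOffer ⨟
                star (test .offerItemIsArg) ⨟ ntest .offerItemIsArg ⨟
                act .readHead ⨟
                (ntest .offerIsHNext ⊞ test .offerIsHNext ⨟ cas .headIsH .headToOffer) ⨟ finOf i)))
  | appendChecked => one ⨟ (ntest .nIsNull ⨟ cas .tailIsT .tailToN ⊞
          test .nIsNull ⨟
            (ntest .tNextIsN ⊞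
              arw .tNextIsN .linkOffer ⨟ cas .tailIsT .tailToOffer ⨟
                star (test .offerItemIsArg) ⨟ ntest .offerItemIsArg ⨟
                act .readHead ⨟
                (ntest .offerIsHNext ⊞ test .offerIsHNext ⨟ cas .headIsH .headToOffer) ⨟ finOf i))
  | tailCas => one ⨟ cas .tailIsT .tailToN
  | linkCas => one ⨟ (ntest .tNextIsN ⊞
              arw .tNextIsN .linkOffer ⨟ cas .tailIsT .tailToOffer ⨟
                star (test .offerItemIsArg) ⨟ ntest .offerItemIsArg ⨟
                act .readHead ⨟
                (ntest .offerIsHNext ⊞ test .offerIsHNext ⨟ cas .headIsH .headToOffer) ⨟ finOf i)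
  | linked => one ⨟ cas .tailIsT .tailToOffer ⨟
                star (test .offerItemIsArg) ⨟ ntest .offerItemIsArg ⨟
                act .readHead ⨟
                (ntest .offerIsHNext ⊞ test .offerIsHNext ⨟ cas .headIsH .headToOffer) ⨟ finOf i
  | wait => one ⨟ star (test .offerItemIsArg) ⨟ ntest .offerItemIsArg ⨟
                act .readHead ⨟
                (ntest .offerIsHNext ⊞ test .offerIsHNext ⨟ cas .headIsH .headToOffer) ⨟ finOf i
  | waiting => (one ⨟ star (test .offerItemIsArg)) ⨟ ntest .offerItemIsArg ⨟
                act .readHead ⨟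
                (ntest .offerIsHNext ⊞ test .offerIsHNext ⨟ cas .headIsH .headToOffer) ⨟ finOf i
  | woken => one ⨟ act .readHead ⨟
      (ntest .offerIsHNext ⊞ test .offerIsHNext ⨟ cas .headIsH .headToOffer) ⨟ finOf i
  | wokenHead => one ⨟
      (ntest .offerIsHNext ⊞ test .offerIsHNext ⨟ cas .headIsH .headToOffer) ⨟ finOf i
  | headCas => (one ⨟ cas .headIsH .headToOffer) ⨟ finOf i
  | finish => one ⨟ finOf i
  | swap => one ⨟ swapBranch (swapOf i)
  | swapNext => one ⨟ (ntest .tailIsT ⊞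
      test .tailIsT ⨟ (ntest .headIsH ⊞
        test .headIsH ⨟ (test .nIsNull ⊞ ntest .nIsNull ⨟ swapOf i)))
  | swapTail => one ⨟ (ntest .headIsH ⊞
        test .headIsH ⨟ (test .nIsNull ⊞ ntest .nIsNull ⨟ swapOf i))
  | swapHead => one ⨟ (test .nIsNull ⊞ ntest .nIsNull ⨟ swapOf i)
  | swapReady => one ⨟ swapOf i
  | swapItem => one ⨟ (test .xIsNull ⨟ cas .headIsH .headToN ⊞
        ntest .xIsNull ⨟
          (arw .nItemIsX .putNull ⨟ cas .headIsH .headToN ⨟ ret ⊞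
            ntest .nItemIsX ⨟ cas .headIsH .headToN))
  | swapCas => one ⨟ (arw .nItemIsX .putNull ⨟ cas .headIsH .headToN ⨟ ret ⊞
            ntest .nItemIsX ⨟ cas .headIsH .headToN)
  | swapped => one ⨟ cas .headIsH .headToN ⨟ ret
  | missed => one ⨟ cas .headIsH .headToN
  | atRet => one ⨟ ret
  | returned => one

open Kat in
/-- The loop of an operation. -/
def mainLoop (i : QInv V) : Kat Act Tst :=
  star (act .readTail ⨟ act .readHead ⨟
    ((test .hIsT ⊞ ntest .hIsT ⨟ test (.tType (tyOf i))) ⨟ appendBranch (finOf i) ⊞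
      ntest .hIsT ⨟ ntest (.tType (tyOf i)) ⨟ swapBranch (swapOf i)))

/-- The remaining code at a program counter. -/
def PC.code (i : QInv V) : PC → Option (Kat Act Tst)
  | returned => none
  | pc => some (pc.body i ⨟ mainLoop i)

/-- Steps that only read the shared memory. -/
inductive Reads (i : QInv V) (l : Loc V) (g : Shared V) : PC → Loc V → PC → Prop
  | readTail : Reads i l g .loop { l with t := g.tail } .gotTail
  | readHead : Reads i l g .gotTail { l with h := g.head } .gotHead
  | same : l.h = l.t → Reads i l g .gotHead l .append
  | differ : l.h ≠ l.t → Reads i l g .gotHead l .differ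
  | differ' : l.h ≠ l.t → Reads i l g .gotHead l .differ'
  | sameType : (g.node l.t).type = tyOf i → Reads i l g .differ l .append
  | otherType : (g.node l.t).type ≠ tyOf i → Reads i l g .differ' l .swap
  | readTNext : Reads i l g .append { l with n := (g.node l.t).next } .appendNext
  | appendRestart : Reads i l g .appendNext l .loop
  | appendTail : Reads i l g .appendNext l .appendChecked
  | hasNext : l.n ≠ none → Reads i l g .appendChecked l .tailCas
  | isLast : l.n = none → Reads i l g .appendChecked l .linkCas
  | tailCasFail : Reads i l g .tailCas l .loop
  | linkFail : Reads i l g .linkCas l .loop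
  | tailMoved : g.tail ≠ l.t → Reads i l g .linked l .wait
  | wait : Reads i l g .wait l .waiting
  | waiting : Reads i l g .waiting l .waiting
  | wake : (g.node l.offer).item ≠ l.arg → Reads i l g .wait l .woken
  | wake' : (g.node l.offer).item ≠ l.arg → Reads i l g .waiting l .woken
  | wokenHead : Reads i l g .woken { l with h := g.head } .wokenHead
  | notNext : Reads i l g .wokenHead l .finish
  | isNext : (g.node l.h).next = some l.offer → Reads i l g .wokenHead l .headCas
  | headMoved : Reads i l g .headCas l .finish
  | readResult : i = .deq →
      Reads i l g .finish { l with x := (g.node l.offer).item } .atRet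
  | readHNext : Reads i l g .swap { l with n := (g.node l.h).next } .swapNext
  | swapRestart : Reads i l g .swapNext l .loop
  | swapTail : g.tail = l.t → Reads i l g .swapNext l .swapTail
  | swapRestart' : Reads i l g .swapTail l .loop
  | swapHead : g.head = l.h → Reads i l g .swapTail l .swapHead
  | noNext : Reads i l g .swapHead l .loop
  | swapReady : l.n ≠ none → Reads i l g .swapHead l .swapReady
  | enqMissed (v : V) : i = .enq v → (g.node (addr l.n)).item ≠ none →
      Reads i l g .swapReady l .missed
  | readNItem : i = .deq →
      Reads i l g .swapReady { l with x := (g.node (addr l.n)).item } .swapItem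
  | deqMissed : l.x = none → Reads i l g .swapItem l .missed
  | deqReady : l.x ≠ none → Reads i l g .swapItem l .swapCas
  | deqMissed' : (g.node (addr l.n)).item ≠ l.x → Reads i l g .swapCas l .missed
  | swappedFail : g.head ≠ l.h → Reads i l g .swapped l .atRet
  | missedFail : Reads i l g .missed l .loop

/-- The steps of a thread that executes the operation `i`. -/
inductive Move (i : QInv V) (l : Loc V) (g : Shared V) :
    PC → Label (QInv V) (Option V) Act Tst → Loc V → Shared V → PC → Prop
  | act {pc l' pc'} (a : Act) : Reads i l g pc l' pc' → Move i l g pc (.act a) l' g pc'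
  | test {pc l' pc'} (b : Tst) (o : Bool) : Reads i l g pc l' pc' →
      Move i l g pc (.test b o) l' g pc'
  | alloc (a : Act) : Move i l g .start (.act a) { l with offer := g.size }
      { g.setNode g.size ⟨l.arg, tyOf i, none⟩ with size := g.size + 1 } .loop
  | tailToN (b : Tst) : g.tail = l.t →
      Move i l g .tailCas (.arw b .tailToN) l { g with tail := addr l.n } .loop
  | link (b : Tst) : (g.node l.t).next = l.n → Move i l g .linkCas (.arw b .linkOffer) l
      (g.setNode l.t { g.node l.t with next := some l.offer }) .linked
  | tailToOffer (b : Tst) : g.tail = l.t →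
      Move i l g .linked (.arw b .tailToOffer) l { g with tail := l.offer } .wait
  | headToOffer (b : Tst) : g.head = l.h →
      Move i l g .headCas (.arw b .headToOffer) l { g with head := l.offer } .finish
  | put (b : Tst) (v : V) : i = .enq v → (g.node (addr l.n)).item = none →
      Move i l g .swapReady (.arw b .putArg) l
        (g.setNode (addr l.n) { g.node (addr l.n) with item := l.arg }) .swapped
  | take (b : Tst) : (g.node (addr l.n)).item = l.x →
      Move i l g .swapCas (.arw b .putNull) l
        (g.setNode (addr l.n) { g.node (addr l.n) with item := none }) .swapped
  | headToN (b : Tst) : g.head = l.h →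
      Move i l g .swapped (.arw b .headToN) l { g with head := addr l.n } .atRet
  | missedHead (b : Tst) : g.head = l.h →
      Move i l g .missed (.arw b .headToN) l { g with head := addr l.n } .loop
  | ret : Move i l g .atRet (.ret l.x) l g .returned
  | enqRet (v : V) : i = .enq v → Move i l g .finish (.ret l.x) l g .returned

set_option linter.unusedSimpArgs false in
-- Each `PC.body` is literally the residue that a step leaves, including the leading `one` and the
-- bracketing, so that `rfl` identifies the next program counter. `Move` keeps only those guards
-- that the invariant needs, so it over-approximates the code.
theorem move_of_bodyStep {i : QInv V} {l l' : Loc V} {g g' : Shared V} {pc : PC}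
    {ℓ : Label (QInv V) (Option V) Act Tst} {r : Option (Kat Act Tst)} (hpc : pc ≠ .returned)
    (h : (queue V).ThreadStep l g (pc.body i) ℓ l' g' r) :
    ∃ pc', r.map (fun k => k ⨟ mainLoop i) = pc'.code i ∧ Move i l g pc ℓ l' g' pc' := by
  cases pc
  case returned => exact absurd rfl hpc
  all_goals
    clear hpc
    cases i
  all_goals
    simp only [PC.body, appendBranch, swapBranch, swapOf, finOf, cas, queue, actSem, testSem,
      ConcObject.threadStep_seq, ConcObject.threadStep_plus, ConcObject.threadStep_star,
      ConcObject.threadStep_one, ConcObject.threadStep_act, ConcObject.threadStep_test,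
      ConcObject.threadStep_ntest, ConcObject.threadStep_arw, ConcObject.threadStep_ret,
      Kat.nullable_one, Kat.nullable_star, Kat.nullable_act, Kat.nullable_test,
      Kat.nullable_ntest, Kat.nullable_arw, Kat.nullable_seq, Kat.nullable_plus,
      false_and, and_false, exists_false, false_or, or_false, true_and, or_self, or_and_right,
      exists_or] at h
    try casesm* _ ∨ _, _ ∧ _, ∃ _, _
    all_goals subst_vars
  -- The program counter rules out most constructors; among those that leave from the same one, the
  -- guard or the final `rfl` decides.
  all_goals first
      | (refine ⟨_, ?_, .act _ .readHead⟩; rfl)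
      | (refine ⟨_, ?_, .test _ _ (.same (by assumption))⟩; rfl)
      | (refine ⟨_, ?_, .test _ _ (.differ (by assumption))⟩; rfl)
      | (refine ⟨_, ?_, .test _ _ (.differ' (by assumption))⟩; rfl)
      | (refine ⟨_, ?_, .test _ _ (.sameType (by assumption))⟩; rfl)
      | (refine ⟨_, ?_, .test _ _ (.otherType (by assumption))⟩; rfl)
      | (refine ⟨_, ?_, .act _ .readTNext⟩; rfl)
      | (refine ⟨_, ?_, .test _ _ .appendRestart⟩; rfl)
      | (refine ⟨_, ?_, .test _ _ .appendTail⟩; rfl)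
      | (refine ⟨_, ?_, .test _ _ (.hasNext (by assumption))⟩; rfl)
      | (refine ⟨_, ?_, .test _ _ (.isLast (by assumption))⟩; rfl)
      | (refine ⟨_, ?_, .test _ _ .tailCasFail⟩; rfl)
      | (refine ⟨_, ?_, .test _ _ .linkFail⟩; rfl)
      | (refine ⟨_, ?_, .test _ _ (.tailMoved (by assumption))⟩; rfl)
      | (refine ⟨_, ?_, .test _ _ .wait⟩; rfl)
      | (refine ⟨_, ?_, .test _ _ .waiting⟩; rfl)
      | (refine ⟨_, ?_, .test _ _ (.wake (by assumption))⟩; rfl)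
      | (refine ⟨_, ?_, .test _ _ (.wake' (by assumption))⟩; rfl)
      | (refine ⟨_, ?_, .act _ .wokenHead⟩; rfl)
      | (refine ⟨_, ?_, .test _ _ .notNext⟩; rfl)
      | (refine ⟨_, ?_, .test _ _ (.isNext (by assumption))⟩; rfl)
      | (refine ⟨_, ?_, .test _ _ .headMoved⟩; rfl)
      | (refine ⟨_, ?_, .act _ (.readResult rfl)⟩; rfl)
      | (refine ⟨_, ?_, .act _ .readHNext⟩; rfl)
      | (refine ⟨_, ?_, .test _ _ .swapRestart⟩; rfl)
      | (refine ⟨_, ?_, .test _ _ (.swapTail (by assumption))⟩; rfl)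
      | (refine ⟨_, ?_, .test _ _ .swapRestart'⟩; rfl)
      | (refine ⟨_, ?_, .test _ _ (.swapHead (by assumption))⟩; rfl)
      | (refine ⟨_, ?_, .test _ _ .noNext⟩; rfl)
      | (refine ⟨_, ?_, .test _ _ (.swapReady (by assumption))⟩; rfl)
      | (refine ⟨_, ?_, .test _ _ (.enqMissed _ rfl (by assumption))⟩; rfl)
      | (refine ⟨_, ?_, .act _ (.readNItem rfl)⟩; rfl)
      | (refine ⟨_, ?_, .test _ _ (.deqMissed (by assumption))⟩; rfl)
      | (refine ⟨_, ?_, .test _ _ (.deqReady (by assumption))⟩; rfl)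
      | (refine ⟨_, ?_, .test _ _ (.deqMissed' (by assumption))⟩; rfl)
      | (refine ⟨_, ?_, .test _ _ (.swappedFail (by assumption))⟩; rfl)
      | (refine ⟨_, ?_, .test _ _ .missedFail⟩; rfl)
      | (refine ⟨_, ?_, .alloc _⟩; rfl)
      | (refine ⟨_, ?_, .tailToN _ (by assumption)⟩; rfl)
      | (refine ⟨_, ?_, .link _ (by assumption)⟩; rfl)
      | (refine ⟨_, ?_, .tailToOffer _ (by assumption)⟩; rfl)
      | (refine ⟨_, ?_, .headToOffer _ (by assumption)⟩; rfl)
      | (refine ⟨_, ?_, .put _ _ rfl (by assumption)⟩; rfl)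
      | (refine ⟨_, ?_, .take _ (by assumption)⟩; rfl)
      | (refine ⟨_, ?_, .headToN _ (by assumption)⟩; rfl)
      | (refine ⟨_, ?_, .missedHead _ (by assumption)⟩; rfl)
      | (refine ⟨_, ?_, .ret⟩; rfl)
      | (refine ⟨_, ?_, .enqRet _ rfl⟩; rfl)

theorem nullable_body {i : QInv V} {pc : PC} (hpc : pc ≠ .returned) (h : (pc.body i).Nullable) :
    pc = .loop := by
  cases pc
  case loop => rfl
  case returned => exact absurd rfl hpc
  all_goals
    cases i <;> simp only [PC.body, appendBranch, swapBranch, swapOf, finOf, cas, Kat.nullable_one,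
      Kat.nullable_star, Kat.nullable_act, Kat.nullable_test, Kat.nullable_ntest, Kat.nullable_arw,
      Kat.nullable_ret, Kat.nullable_seq, Kat.nullable_plus, and_false, or_self] at h

/-- A step outside the loop body requires the body to be nullable, which happens only at `loop`; it
is then the read of the tail that opens the next iteration. -/
theorem move_of_threadStep {i : QInv V} {l l' : Loc V} {g g' : Shared V} {pc : PC}
    {k : Kat Act Tst} {ℓ : Label (QInv V) (Option V) Act Tst} {r : Option (Kat Act Tst)}
    (hk : pc.code i = some k) (h : (queue V).ThreadStep l g k ℓ l' g' r) :
    ∃ pc', r = pc'.code i ∧ Move i l g pc ℓ l' g' pc' := by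
  have key : pc ≠ .returned ∧ k = (pc.body i ⨟ mainLoop i) := by
    cases pc <;> simp_all [PC.code]
  obtain ⟨hpc, rfl⟩ := key
  rcases ConcObject.threadStep_seq.1 h with ⟨r₀, h₁, rfl⟩ | ⟨hn, h₁⟩
  · exact move_of_bodyStep hpc h₁
  · obtain rfl := nullable_body hpc hn
    simp only [mainLoop, ConcObject.threadStep_star, ConcObject.threadStep_seq,
      ConcObject.threadStep_act, Kat.nullable_act, false_and, or_false] at h₁
    obtain ⟨_, ⟨_, ⟨rfl, rfl, rfl, rfl⟩, rfl⟩, rfl⟩ := h₁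
    exact ⟨.gotTail, rfl, .act _ .readTail⟩

open Computability

/-! ### The languages of layers and of linearization points -/

theorem flatMap_mem_kstar {α β : Type*} {L : Language α} {l : List β} {f : β → List α}
    (h : ∀ x ∈ l, f x ∈ L) : l.flatMap f ∈ L∗ :=
  Language.mem_kstar.2 ⟨l.map f, List.flatMap_def, by simpa using h⟩

theorem append_mem_kstar {α : Type*} {L : Language α} {u v : List α} (hu : u ∈ L) (hv : v ∈ L∗) :
    u ++ v ∈ L∗ := by
  obtain ⟨l, rfl, hl⟩ := Language.mem_kstar.1 hv
  exact Language.mem_kstar.2 ⟨u :: l, by simp, by simpa using ⟨hu, hl⟩⟩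

theorem append_mem_kstar' {α : Type*} {L : Language α} {u v : List α} (hu : u ∈ L∗)
    (hv : v ∈ L∗) : u ++ v ∈ L∗ := by
  obtain ⟨l, rfl, hl⟩ := Language.mem_kstar.1 hu
  obtain ⟨l', rfl, hl'⟩ := Language.mem_kstar.1 hv
  refine Language.mem_kstar.2 ⟨l ++ l', by simp, fun y hy => ?_⟩
  rcases List.mem_append.1 hy with h | h
  exacts [hl y h, hl' y h]

/-- If `f` maps the words of `L` into `K*`, it maps the words of `L*` into `K*`. -/
theorem flatMap_kstar_mem {α β : Type*} {L : Language α} {K : Language β} {f : α → List β}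
    (h : ∀ u ∈ L, u.flatMap f ∈ K∗) {u : List α} (hu : u ∈ L∗) : u.flatMap f ∈ K∗ := by
  obtain ⟨l, rfl, hl⟩ := Language.mem_kstar.1 hu
  clear hu
  induction l with
  | nil => exact Language.nil_mem_kstar _
  | cons a l ih =>
    rw [List.flatten_cons, List.flatMap_append]
    exact append_mem_kstar' (h a (hl a (by simp))) (ih fun y hy => hl y (by simp [hy]))

/-- A bracket opened by `Dapp` projects to `(ED)*·ED` and one opened by `Eapp` to `E·(DE)*·D`; both
lie in `(ED)*`. -/
theorem flatMap_marks_mem_pointExpr {w : List Layer} (hw : w ∈ layerExpr.matches') :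
    w.flatMap marks ∈ pointExpr.matches' := by
  simp only [layerExpr, RegularExpression.matches'] at hw
  simp only [pointExpr, RegularExpression.matches']
  have hED : ([.E, .D] : List ED) ∈ ({[.E]} : Language ED) * {[.D]} :=
    ⟨_, rfl, _, rfl, rfl⟩
  obtain ⟨u, hu, v, hv, rfl⟩ := hw
  simp only [List.flatMap_append]
  refine ⟨_, flatMap_kstar_mem ?_ hu, _, ?_, rfl⟩
  · rintro _ (⟨_, ⟨_, ⟨_, ⟨_, rfl, _, rfl, rfl⟩, z, hz, rfl⟩, _, rfl, rfl⟩, _, rfl, rfl⟩ |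
      ⟨_, ⟨_, ⟨_, ⟨_, rfl, _, rfl, rfl⟩, z, hz, rfl⟩, _, rfl, rfl⟩, _, rfl, rfl⟩)
    · simp only [List.flatMap_append]
      refine append_mem_kstar' (append_mem_kstar' (append_mem_kstar' (Language.nil_mem_kstar _)
        (flatMap_kstar_mem ?_ hz)) ?_) (Language.nil_mem_kstar _)
      · rintro _ ⟨_, ⟨_, ⟨_, rfl, _, rfl, rfl⟩, _, rfl, rfl⟩, _, rfl, rfl⟩
        exact append_mem_kstar hED (Language.nil_mem_kstar _)
      · exact append_mem_kstar hED (Language.nil_mem_kstar _)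
    -- The single iterations project to `D·E`, so the star cannot be treated factor by factor;
    -- `E(DE)ⁿD` is regrouped as `(ED)ⁿ⁺¹` by induction.
    · obtain ⟨l, rfl, hl⟩ := Language.mem_kstar.1 hz
      clear hu hz
      induction l with
      | nil => simpa [marks] using append_mem_kstar hED (Language.nil_mem_kstar _)
      | cons a l ih =>
        have ih := ih fun y hy => hl y (by simp [hy])
        obtain ⟨_, ⟨_, ⟨_, rfl, _, rfl, rfl⟩, _, rfl, rfl⟩, _, rfl, rfl⟩ := hl a (by simp)
        simpa [marks] using append_mem_kstar hED ih
  -- Pending reservations leave no mark, so both alternatives end in `E*`.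
  · rcases hv with hv | hv
    · refine .inl (flatMap_kstar_mem ?_ hv)
      rintro _ ⟨_, rfl, _, rfl, rfl⟩
      exact Language.nil_mem_kstar _
    · refine .inl (flatMap_kstar_mem ?_ hv)
      rintro _ ⟨_, rfl, _, rfl, rfl⟩
      exact append_mem_kstar (u := [ED.E]) rfl (Language.nil_mem_kstar _)

/-- The layer that appends a node of a given type. -/
def appendLayer : NodeType → Layer
  | .item => .Eapp
  | .reservation => .Dapp

/-- The layer that exchanges the item of a node of a given type. -/
def swapLayer : NodeType → Layer
  | .item => .Dswap
  | .reservation => .Eswap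

/-- The layers for the `k`-th appended node, when the tail, the exchanges and the head have
passed `tl`, `sw` and `hd` appended nodes. -/
def letters (ty : NodeType) (tl sw hd k : ℕ) : List Layer :=
  appendLayer ty :: ((if k < tl then [.TA] else []) ++ (if k < sw then [swapLayer ty] else []) ++
    (if k < hd then [.HR] else []))

/-- With no write pending, each of the first `sw` blocks has all four letters and matches a bracket
with empty inner star; the remaining blocks are append and `TA`, all of one type. -/
theorem flatMap_letters_mem_layerExpr {ty : ℕ → NodeType} {sw m : ℕ} (h : sw ≤ m)
    (hty : ∀ j k, sw ≤ j → j < m → sw ≤ k → k < m → ty j = ty k) :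
    (List.range m).flatMap (fun k => letters (ty k) m sw sw k) ∈ layerExpr.matches' := by
  simp only [layerExpr, RegularExpression.matches']
  obtain ⟨d, rfl⟩ := Nat.exists_eq_add_of_le h
  rw [List.range_add, List.flatMap_append, List.flatMap_map]
  refine ⟨_, flatMap_mem_kstar fun k hk => ?_, _, ?_, rfl⟩
  · have hk : k < sw := by simpa using hk
    simp only [letters, hk, Nat.lt_add_right d hk, if_true]
    cases ty k
    · exact .inr ⟨_, ⟨_, ⟨_, ⟨_, rfl, _, rfl, rfl⟩, [], Language.nil_mem_kstar _, rfl⟩, _, rfl, rfl⟩,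
        _, rfl, rfl⟩
    · exact .inl ⟨_, ⟨_, ⟨_, ⟨_, rfl, _, rfl, rfl⟩, [], Language.nil_mem_kstar _, rfl⟩, _, rfl, rfl⟩,
        _, rfl, rfl⟩
  · have key : ∀ k ∈ List.range d, letters (ty (sw + k)) (sw + d) sw sw (sw + k) =
        [appendLayer (ty sw), .TA] := by
      intro k hk
      have hk : k < d := by simpa using hk
      rw [hty (sw + k) sw (by omega) (by omega) (by omega) (by omega)]
      simp [letters, hk]
    cases hs : ty sw
    · refine .inr (flatMap_mem_kstar fun k hk => ?_)
      rw [key k hk, hs]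
      exact ⟨_, rfl, _, rfl, rfl⟩
    · refine .inl (flatMap_mem_kstar fun k hk => ?_)
      rw [key k hk, hs]
      exact ⟨_, rfl, _, rfl, rfl⟩

/-! ### Rearranging the writes -/

theorem Exchange.append_right {u v : List (T × Layer)} (h : Exchange u v) (z : List (T × Layer)) :
    Exchange (u ++ z) (v ++ z) := by
  obtain ⟨u, v, x, y, h₁, h₂, h₃⟩ := h
  simpa using Exchange.mk u (v ++ z) x y h₁ h₂ h₃

theorem exchanges_append_right {u v : List (T × Layer)} (h : Relation.ReflTransGen Exchange u v)
    (z : List (T × Layer)) : Relation.ReflTransGen Exchange (u ++ z) (v ++ z) :=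
  h.lift (· ++ z) fun _ _ h => h.append_right z

theorem exchanges_move (u v : List (T × Layer)) (y : T × Layer)
    (h : ∀ x ∈ v, x.1 ≠ y.1 ∧ x.2.TailSide ∧ y.2.HeadSide) :
    Relation.ReflTransGen Exchange (u ++ v ++ [y]) (u ++ [y] ++ v) := by
  induction v generalizing u with
  | nil => simpa using Relation.ReflTransGen.refl
  | cons x v ih =>
    have h₁ := ih (u ++ [x]) fun z hz => h z (by simp [hz])
    obtain ⟨hx₁, hx₂, hx₃⟩ := h x (by simp)
    have h₂ := Exchange.mk u v x y hx₁ hx₂ hx₃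
    simp only [List.append_assoc, List.cons_append, List.nil_append] at h₁ ⊢
    exact h₁.tail h₂

/-- A write for the `k`-th block moves into its block. -/
theorem exchanges_insert (W : ℕ → List (T × Layer)) (y : T × Layer) {k m : ℕ} (hk : k < m)
    (h : ∀ j, k < j → j < m → ∀ x ∈ W j, x.1 ≠ y.1 ∧ x.2.TailSide ∧ y.2.HeadSide) :
    Relation.ReflTransGen Exchange ((List.range m).flatMap W ++ [y])
      ((List.range m).flatMap (Function.update W k (W k ++ [y]))) := by
  induction m with
  | zero => omega
  | succ m ih =>
    -- The new letter first passes the last block and then, by induction, the earlier ones.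
    rcases Nat.lt_succ_iff_lt_or_eq.1 hk with hkm | rfl
    · have h₁ := exchanges_append_right (ih hkm fun j hj hjm => h j hj (by omega)) (W m)
      have h₂ := exchanges_move ((List.range m).flatMap W) (W m) y (h m hkm (by omega))
      simp only [List.range_succ, List.flatMap_append, List.flatMap_singleton,
        Function.update_of_ne (show m ≠ k by omega)]
      exact h₂.trans h₁
    · have : (List.range k).flatMap (Function.update W k (W k ++ [y])) =
          (List.range k).flatMap W := by
        refine List.flatMap_congr fun j hj => ?_
        rw [Function.update_of_ne]
        simp at hj
        omega
      simp only [List.range_succ, List.flatMap_append, List.flatMap_singleton, this,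
        Function.update_self, ← List.append_assoc]
      exact .refl

theorem writes_append_of_some {env : T → Option (QInv V)}
    {τ : List (T × Label (QInv V) (Option V) Act Tst)} {t : T} {i : QInv V}
    {ℓ : Label (QInv V) (Option V) Act Tst} {y : Layer} (hi : env t = some i)
    (hy : layerOf i ℓ = some y) : writes env (τ ++ [(t, ℓ)]) = writes env τ ++ [(t, y)] := by
  simp [writes, hi, hy]

theorem writes_append_of_none {env : T → Option (QInv V)}
    {τ : List (T × Label (QInv V) (Option V) Act Tst)} {t : T} {i : QInv V}
    {ℓ : Label (QInv V) (Option V) Act Tst} (hi : env t = some i)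
    (hy : layerOf i ℓ = none) : writes env (τ ++ [(t, ℓ)]) = writes env τ := by
  simp [writes, hi, hy]

/-! ### The invariant -/

/-- The part of a thread in the list: none, appending node `k + 1`, or exchanging its item. -/
inductive Role where
  | free
  | app (k : ℕ)
  | swp (k : ℕ)

/-- The history of a configuration. The list of nodes ever appended is `a 0, …, a m`; the tail has
passed `tl` appended nodes, the head `hd`, and the items of `sw` appended nodes have been
exchanged. Node `a (k + 1)` was appended with the item `val k`, gives rise to the writes `W k` and
to the linearized operations `S k`, and its item was exchanged at position `pos k` of the trace. -/
structure Ghost (V T : Type*) where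
  a : ℕ → ℕ
  ty : ℕ → NodeType
  m : ℕ
  tl : ℕ
  hd : ℕ
  sw : ℕ
  role : T → Role
  own : ℕ → Option T
  val : ℕ → Option V
  W : ℕ → List (T × Layer)
  S : ℕ → List (T × QInv V × Option V)
  pos : ℕ → ℕ

/-- The shared memory agrees with the history. -/
structure Mem (G : Ghost V T) (g : Shared V) : Prop where
  hd_le : G.hd ≤ G.sw
  sw_le_hd : G.sw ≤ G.hd + 1
  sw_le : G.sw ≤ G.tl
  tl_le : G.tl ≤ G.m
  le_tl : G.m ≤ G.tl + 1
  head : g.head = G.a G.hd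
  tail : g.tail = G.a G.tl
  lt_size : ∀ k ≤ G.m, G.a k < g.size
  inj : ∀ j ≤ G.m, ∀ k ≤ G.m, G.a j = G.a k → j = k
  next : ∀ k < G.m, (g.node (G.a k)).next = some (G.a (k + 1))
  last : (g.node (G.a G.m)).next = none
  type : ∀ k ≤ G.m, (g.node (G.a k)).type = G.ty k
  -- These indices run over the nodes strictly beyond the head.
  same : ∀ j k, G.hd ≤ j → j < G.m → G.hd ≤ k → k < G.m → G.ty (j + 1) = G.ty (k + 1)
  item : ∀ k, G.sw ≤ k → k < G.m → (g.node (G.a (k + 1))).item = G.val k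
  -- Since `own` is a function, this gives every appended node a unique appender.
  app : ∀ t k, G.role t = .app k → k < G.m ∧ G.own (G.a (k + 1)) = some t
  swp : ∀ t k, G.role t = .swp k → k < G.sw

/-- The operations that take part in block `k`. -/
inductive Block (env : T → Option (QInv V)) (G : Ghost V T) (g : Shared V) (k : ℕ) : Prop
  | item (t : T) (v : V) : G.sw ≤ k → G.role t = .app k → env t = some (.enq v) →
      G.ty (k + 1) = .item → G.val k = some v → G.S k = [(t, .enq v, none)] → Block env G g k
  | reservation (t : T) : G.sw ≤ k → G.role t = .app k → env t = some .deq →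
      G.ty (k + 1) = .reservation → G.val k = none → G.S k = [] → Block env G g k
  | taken (t u : T) (v : V) : k < G.sw → G.role t = .app k → env t = some (.enq v) →
      G.role u = .swp k → env u = some .deq → G.ty (k + 1) = .item → G.val k = some v →
      (g.node (G.a (k + 1))).item = none →
      G.S k = [(t, .enq v, none), (u, .deq, some v)] → Block env G g k
  | filled (t u : T) (v : V) : k < G.sw → G.role t = .app k → env t = some .deq →
      G.role u = .swp k → env u = some (.enq v) → G.ty (k + 1) = .reservation →
      G.val k = none → (g.node (G.a (k + 1))).item = some v →
      G.S k = [(u, .enq v, none), (t, .deq, some v)] → Block env G g k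

/-- The writes of block `k`. -/
structure BlockWrites (env : T → Option (QInv V)) (G : Ghost V T) (k : ℕ) : Prop where
  letters : (G.W k).map Prod.snd = letters (G.ty (k + 1)) G.tl G.sw G.hd k
  -- This is what keeps a head-side write from having to pass a write of its own thread. A tail-side
  -- write in block `k` comes from the appender of that block, or from a helper that found `a k` to
  -- be of its own type or not beyond the head.
  writer : ∀ x ∈ G.W k, x.2.TailSide → (∀ j, G.role x.1 = .app j → k ≤ j) ∧
    (G.role x.1 = .app k ∨ (∃ i, env x.1 = some i ∧ G.ty k = tyOf i) ∨ k ≤ G.hd)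

/-- The own node `o` of `t` has been allocated and not been appended. -/
structure Pre (G : Ghost V T) (g : Shared V) (i : QInv V) (t : T) (o : ℕ) : Prop where
  role : G.role t = .free
  own : G.own o = some t
  lt : o < g.size
  ne : ∀ k ≤ G.m, G.a k ≠ o
  node : g.node o = ⟨argOf i, tyOf i, none⟩

/-- The operation of `t` is complete, up to writes to `head`. -/
def Served (G : Ghost V T) (i : QInv V) (t : T) (l : Loc V) : Prop :=
  -- For an exchanger the head must have passed its block; a pending advance of the head is
  -- therefore always traced to a thread still at `swapped`.
  ∃ k < G.sw, (t, i, l.x) ∈ G.S k ∧ (G.role t = .app k ∨ G.role t = .swp k ∧ k < G.hd)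

/-- What is known when thread `t`, executing `i`, is at a program counter. -/
def At (G : Ghost V T) (g : Shared V) (i : QInv V) (t : T) (l : Loc V) : PC → Prop
  | .start => G.role t = .free
  | .loop => Pre G g i t l.offer
  | .gotTail => Pre G g i t l.offer ∧ ∃ p ≤ G.tl, l.t = G.a p
  | .gotHead | .differ => Pre G g i t l.offer ∧ ∃ p ≤ G.tl, l.t = G.a p ∧ ∃ q ≤ G.hd, l.h = G.a q
  | .differ' => Pre G g i t l.offer ∧ ∃ p ≤ G.tl, l.t = G.a p ∧ ∃ q ≤ G.hd, l.h = G.a q ∧ p ≠ q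
  | .append => Pre G g i t l.offer ∧ ∃ p ≤ G.tl, l.t = G.a p ∧ (G.ty p = tyOf i ∨ p ≤ G.hd)
  | .appendNext | .appendChecked => Pre G g i t l.offer ∧ ∃ p ≤ G.tl, l.t = G.a p ∧
      (G.ty p = tyOf i ∨ p ≤ G.hd) ∧ (l.n = none ∨ p < G.m ∧ l.n = some (G.a (p + 1)))
  | .tailCas => Pre G g i t l.offer ∧ ∃ p ≤ G.tl, l.t = G.a p ∧
      (G.ty p = tyOf i ∨ p ≤ G.hd) ∧ p < G.m ∧ l.n = some (G.a (p + 1))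
  | .linkCas => Pre G g i t l.offer ∧ ∃ p ≤ G.tl, l.t = G.a p ∧
      (G.ty p = tyOf i ∨ p ≤ G.hd) ∧ l.n = none
  | .linked => ∃ k < G.m, G.role t = .app k ∧ l.offer = G.a (k + 1) ∧ l.t = G.a k ∧ k ≤ G.tl
  | .wait | .waiting => ∃ k < G.tl, G.role t = .app k ∧ l.offer = G.a (k + 1)
  | .woken | .finish => ∃ k < G.sw, G.role t = .app k ∧ l.offer = G.a (k + 1)
  | .wokenHead => ∃ k < G.sw, G.role t = .app k ∧ l.offer = G.a (k + 1) ∧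
      ∃ q ≤ G.hd, l.h = G.a q
  | .headCas => ∃ k < G.sw, G.role t = .app k ∧ l.offer = G.a (k + 1) ∧ l.h = G.a k
  | .swap => Pre G g i t l.offer ∧ ∃ p ≤ G.tl, l.t = G.a p ∧ G.ty p ≠ tyOf i ∧
      ∃ q ≤ G.hd, l.h = G.a q ∧ p ≠ q
  | .swapNext => Pre G g i t l.offer ∧ ∃ p ≤ G.tl, l.t = G.a p ∧ G.ty p ≠ tyOf i ∧
      ∃ q ≤ G.hd, l.h = G.a q ∧ p ≠ q ∧ (l.n = none ∨ q < G.m ∧ l.n = some (G.a (q + 1)))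
  | .swapTail => Pre G g i t l.offer ∧ ∃ p ≤ G.tl, G.ty p ≠ tyOf i ∧
      ∃ q ≤ G.hd, l.h = G.a q ∧ q < p ∧ (l.n = none ∨ l.n = some (G.a (q + 1)))
  | .swapHead => Pre G g i t l.offer ∧ ∃ q ≤ G.hd, l.h = G.a q ∧ q < G.tl ∧ G.ty (q + 1) ≠ tyOf i ∧
      (l.n = none ∨ l.n = some (G.a (q + 1)))
  | .swapReady => Pre G g i t l.offer ∧ ∃ q ≤ G.hd, l.h = G.a q ∧ q < G.tl ∧ G.ty (q + 1) ≠ tyOf i ∧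
      l.n = some (G.a (q + 1))
  | .swapItem => i = .deq ∧ Pre G g i t l.offer ∧ ∃ q ≤ G.hd, l.h = G.a q ∧ q < G.tl ∧
      G.ty (q + 1) ≠ tyOf i ∧ l.n = some (G.a (q + 1)) ∧ (l.x = none → q < G.sw) ∧
      (l.x ≠ none → l.x = G.val q)
  | .swapCas => i = .deq ∧ Pre G g i t l.offer ∧ ∃ q ≤ G.hd, l.h = G.a q ∧ q < G.tl ∧
      G.ty (q + 1) ≠ tyOf i ∧ l.n = some (G.a (q + 1)) ∧ l.x ≠ none ∧ l.x = G.val q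
  | .swapped => ∃ k < G.sw, G.role t = .swp k ∧ l.h = G.a k ∧ l.n = some (G.a (k + 1)) ∧
      G.ty (k + 1) ≠ tyOf i ∧ (t, i, l.x) ∈ G.S k
  | .missed => Pre G g i t l.offer ∧ ∃ q ≤ G.hd, l.h = G.a q ∧ q < G.sw ∧ G.ty (q + 1) ≠ tyOf i ∧
      l.n = some (G.a (q + 1))
  | .atRet | .returned => Served G i t l

/-- A thread that has been invoked. -/
def ThreadOK (env : T → Option (QInv V)) (G : Ghost V T) (g : Shared V) (t : T) (l : Loc V)
    (k : Option (Kat Act Tst)) : Prop :=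
  ∃ i pc, env t = some i ∧ k = pc.code i ∧ l.arg = argOf i ∧ (i ≠ .deq → l.x = none) ∧
    At G g i t l pc

/-- The trace agrees with the history. -/
structure Hist (env : T → Option (QInv V)) (G : Ghost V T)
    (τ : List (T × Label (QInv V) (Option V) Act Tst))
    (th : T → Option (Loc V × Option (Kat Act Tst))) : Prop where
  idle : ∀ t, th t = none → ∀ ℓ, (t, ℓ) ∉ τ
  invoked : ∀ t, th t ≠ none → ∀ i, env t = some i → (t, .inv i) ∈ τ
  returned : ∀ t r, (t, .ret r) ∈ τ → ∃ i, ∃ k < G.sw, (t, i, r) ∈ G.S k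
  -- The last position of the trace has to lie strictly after the invocation, since it serves as the
  -- linearization point of unmatched enqueues.
  inv_lt : ∀ t, G.role t ≠ .free → ∀ (j : ℕ) i, τ[j]? = some (t, .inv i) → j + 1 < τ.length
  pos_lt : ∀ k < G.sw, G.pos k < τ.length
  mono : ∀ j k, j ≤ k → k < G.sw → G.pos j ≤ G.pos k
  pos_inv : ∀ k < G.sw, ∀ t, G.role t = .app k ∨ G.role t = .swp k →
    ∀ (j : ℕ) i, τ[j]? = some (t, .inv i) → j < G.pos k
  pos_ret : ∀ k < G.sw, ∀ t, G.role t = .app k ∨ G.role t = .swp k →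
    ∀ (j : ℕ) r, τ[j]? = some (t, .ret r) → G.pos k < j

/-- The invariant of executions. -/
structure Inv (env : T → Option (QInv V)) (G : Ghost V T)
    (τ : List (T × Label (QInv V) (Option V) Act Tst)) (g : Shared V)
    (th : T → Option (Loc V × Option (Kat Act Tst))) : Prop where
  mem : Mem G g
  block : ∀ k < G.m, Block env G g k
  blockWrites : ∀ k < G.m, BlockWrites env G k
  idle : ∀ t, th t = none → G.role t = .free
  thread : ∀ t l k, th t = some (l, k) → ThreadOK env G g t l k
  hist : Hist env G τ th
  writes : Relation.ReflTransGen Exchange (writes env τ) ((List.range G.m).flatMap G.W)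

/-! ### Reading steps, from the point of view of the thread that performs them. -/

section Basic

variable {env : T → Option (QInv V)} {G G' : Ghost V T} {g g' : Shared V} {i : QInv V} {t : T}
  {l l' : Loc V} {pc pc' : PC} {k : ℕ}

theorem Mem.app_inj (hm : Mem G g) {u : T} (ht : G.role t = .app k) (hu : G.role u = .app k) :
    t = u :=
  Option.some.inj ((hm.app t k ht).2.symm.trans (hm.app u k hu).2)

theorem Block.role_of_mem (hb : Block env G g k) {x : T × QInv V × Option V} (hx : x ∈ G.S k) :
    (G.role x.1 = .app k ∨ G.role x.1 = .swp k) ∧ env x.1 = some x.2.1 := by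
  cases hb <;> simp_all <;> aesop

/-- The item of an appended node of type `item` is null exactly when it has been exchanged. -/
theorem Block.item_cases (hm : Mem G g) (hb : Block env G g k) (hk : k < G.m)
    (hty : G.ty (k + 1) ≠ .reservation) :
    k < G.sw ∧ (g.node (G.a (k + 1))).item = none ∨
      G.sw ≤ k ∧ (g.node (G.a (k + 1))).item = G.val k ∧ G.val k ≠ none := by
  cases hb <;> simp_all [hm.item k]

/-- Pointers that were read become indices into the list `a`, and pointer tests become relations
between indices. This works because `a` is injective, which excludes the ABA problem. -/
theorem Reads.at (h : Reads i l g pc l' pc') (hm : Mem G g) (hb : ∀ k < G.m, Block env G g k)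
    (hi : env t = some i) (harg : l.arg = argOf i) (hx : i ≠ .deq → l.x = none)
    (ha : At G g i t l pc) :
    l'.arg = argOf i ∧ (i ≠ .deq → l'.x = none) ∧ At G g i t l' pc' := by
  have := hm.hd_le
  have := hm.sw_le_hd
  have := hm.sw_le
  have := hm.tl_le
  have := hm.le_tl
  have hnext : ∀ p ≤ G.m, (g.node (G.a p)).next = none ∨
      p < G.m ∧ (g.node (G.a p)).next = some (G.a (p + 1)) := fun p hp => by
    rcases hp.lt_or_eq with hp | rfl
    exacts [.inr ⟨hp, hm.next p hp⟩, .inl hm.last]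
  cases h
  case readTail => exact ⟨harg, hx, ha, G.tl, le_rfl, hm.tail⟩
  case readHead =>
    obtain ⟨hp, p, h₁, h₂⟩ := ha
    exact ⟨harg, hx, hp, p, h₁, h₂, G.hd, le_rfl, hm.head⟩
  case same h =>
    obtain ⟨hp, p, h₁, h₂, q, h₃, h₄⟩ := ha
    have : p = q := hm.inj p (by omega) q (by omega) (by rw [← h₂, ← h₄, h])
    exact ⟨harg, hx, hp, p, h₁, h₂, .inr (by omega)⟩
  case differ => exact ⟨harg, hx, ha⟩
  case differ' h =>
    obtain ⟨hp, p, h₁, h₂, q, h₃, h₄⟩ := ha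
    exact ⟨harg, hx, hp, p, h₁, h₂, q, h₃, h₄, fun e => h (by rw [h₂, h₄, e])⟩
  case sameType h =>
    obtain ⟨hp, p, h₁, h₂, -⟩ := ha
    exact ⟨harg, hx, hp, p, h₁, h₂, .inl (by rw [← h, h₂, hm.type p (by omega)])⟩
  case otherType h =>
    obtain ⟨hp, p, h₁, h₂, q, h₃⟩ := ha
    exact ⟨harg, hx, hp, p, h₁, h₂, by rwa [← hm.type p (by omega), ← h₂], q, h₃⟩
  case readTNext =>
    obtain ⟨hp, p, h₁, h₂, h₃⟩ := ha
    exact ⟨harg, hx, hp, p, h₁, h₂, h₃, by simpa [h₂] using hnext p (by omega)⟩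
  case appendRestart => exact ⟨harg, hx, ha.1⟩
  case appendTail => exact ⟨harg, hx, ha⟩
  case hasNext h =>
    obtain ⟨hp, p, h₁, h₂, h₃, h₄⟩ := ha
    exact ⟨harg, hx, hp, p, h₁, h₂, h₃, h₄.resolve_left h⟩
  case isLast h =>
    obtain ⟨hp, p, h₁, h₂, h₃, -⟩ := ha
    exact ⟨harg, hx, hp, p, h₁, h₂, h₃, h⟩
  case tailCasFail => exact ⟨harg, hx, ha.1⟩
  case linkFail => exact ⟨harg, hx, ha.1⟩
  case tailMoved h =>
    obtain ⟨k, h₁, h₂, h₃, h₄, h₅⟩ := ha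
    refine ⟨harg, hx, k, h₅.lt_of_ne fun e => h ?_, h₂, h₃⟩
    rw [hm.tail, h₄, e]
  case wait => exact ⟨harg, hx, ha⟩
  case waiting => exact ⟨harg, hx, ha⟩
  case wake h | wake' h =>
    obtain ⟨k, h₁, h₂, h₃⟩ := ha
    refine ⟨harg, hx, k, ?_, h₂, h₃⟩
    -- Until the exchange the node holds the initial item, which is the argument of its appender.
    by_contra hk
    refine h ?_
    rw [h₃, hm.item k (by omega) (by omega), harg]
    have hb := hb k (by omega)
    cases hb with
    | item t' v _ h₄ h₅ _ h₆ =>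
      obtain rfl := hm.app_inj h₂ h₄
      obtain rfl := Option.some.inj (hi.symm.trans h₅)
      exact h₆
    | reservation t' _ h₄ h₅ _ h₆ =>
      obtain rfl := hm.app_inj h₂ h₄
      obtain rfl := Option.some.inj (hi.symm.trans h₅)
      exact h₆
    | taken | filled => omega
  case wokenHead =>
    obtain ⟨k, h₁, h₂, h₃⟩ := ha
    exact ⟨harg, hx, k, h₁, h₂, h₃, G.hd, le_rfl, hm.head⟩
  case notNext =>
    obtain ⟨k, h₁, h₂, h₃, -⟩ := ha
    exact ⟨harg, hx, k, h₁, h₂, h₃⟩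
  case isNext h =>
    obtain ⟨k, h₁, h₂, h₃, q, h₄, h₅⟩ := ha
    refine ⟨harg, hx, k, h₁, h₂, h₃, ?_⟩
    rw [h₅, h₃] at h
    rcases hnext q (by omega) with h₆ | ⟨h₆, h₇⟩
    · simp [h] at h₆
    -- A node has only one predecessor in the list, so the head that was read is the node just
    -- before the own one.
    · have := hm.inj _ (by omega) _ (by omega) (Option.some.inj (h.symm.trans h₇))
      rw [h₅, Nat.succ_injective this]
  case headMoved =>
    obtain ⟨k, h₁, h₂, h₃, -⟩ := ha
    exact ⟨harg, hx, k, h₁, h₂, h₃⟩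
  case readResult h =>
    obtain ⟨k, h₁, h₂, h₃⟩ := ha
    refine ⟨harg, fun h' => absurd h h', k, h₁, ?_, .inl h₂⟩
    have hb := hb k (by omega)
    cases hb with
    | item | reservation => omega
    | taken t' _ _ _ h₄ h₅ =>
      obtain rfl := hm.app_inj h₂ h₄
      obtain rfl := Option.some.inj (hi.symm.trans h₅)
      exact nomatch h
    | filled t' u v _ h₄ _ _ _ _ _ h₅ h₆ =>
      obtain rfl := hm.app_inj h₂ h₄
      -- A filled reservation keeps its item, so the value read is the one recorded in the block.
      simp [h₃, h₅, h₆, h]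
  case readHNext =>
    obtain ⟨hp, p, h₁, h₂, h₃, q, h₄, h₅, h₆⟩ := ha
    exact ⟨harg, hx, hp, p, h₁, h₂, h₃, q, h₄, h₅, h₆, by simpa [h₅] using hnext q (by omega)⟩
  case swapRestart => exact ⟨harg, hx, ha.1⟩
  case swapTail h =>
    obtain ⟨hp, p, h₁, h₂, h₃, q, h₄, h₅, h₆, h₇⟩ := ha
    -- The test identifies `p` with the present `tl`; hence `q ≤ hd ≤ p`, and `q ≠ p` makes this
    -- strict.
    have := hm.inj G.tl (by omega) p (by omega) (by rw [← hm.tail, ← h₂, h])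
    exact ⟨harg, hx, hp, p, h₁, h₃, q, h₄, h₅, by omega, h₇.imp_right And.right⟩
  case swapRestart' => exact ⟨harg, hx, ha.1⟩
  case swapHead h =>
    obtain ⟨hp, p, h₁, h₃, q, h₄, h₅, h₆, h₇⟩ := ha
    -- The head is still at `q < p`, so nodes `q + 1` and `p` both lie beyond it and have the same
    -- type. This is why testing the tail and then the head suffices, although the two tests are not
    -- simultaneous.
    have := hm.inj G.hd (by omega) q (by omega) (by rw [← hm.head, ← h₅, h])
    refine ⟨harg, hx, hp, q, h₄, h₅, by omega, ?_, h₇⟩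
    obtain ⟨p, rfl⟩ : ∃ p', p = p' + 1 := ⟨p - 1, by omega⟩
    rwa [hm.same q p (by omega) (by omega) (by omega) (by omega)]
  case noNext => exact ⟨harg, hx, ha.1⟩
  case swapReady h =>
    obtain ⟨hp, q, h₁, h₂, h₃, h₄, h₅⟩ := ha
    exact ⟨harg, hx, hp, q, h₁, h₂, h₃, h₄, h₅.resolve_left h⟩
  case enqMissed v rfl h =>
    obtain ⟨hp, q, h₁, h₂, h₃, h₄, h₅⟩ := ha
    refine ⟨harg, hx, hp, q, h₁, h₂, ?_, h₄, h₅⟩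
    by_contra hq
    rw [h₅, addr, Option.getD_some, hm.item q (by omega) (by omega)] at h
    have hb := hb q (by omega)
    cases hb with
    | item => simp_all [tyOf]
    | reservation => simp_all
    | taken | filled => omega
  case readNItem h =>
    obtain ⟨hp, q, h₁, h₂, h₃, h₄, h₅⟩ := ha
    refine ⟨harg, fun h' => absurd h h', h, hp, q, h₁, h₂, h₃, h₄, h₅, ?_⟩
    subst h
    simp only [h₅, addr, Option.getD_some]
    rcases Block.item_cases hm (hb q (by omega)) (by omega) h₄ with ⟨h₆, h₇⟩ | ⟨h₆, h₇, h₈⟩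
    · exact ⟨fun _ => h₆, fun h => absurd h₇ h⟩
    · exact ⟨fun h => absurd (h₇.symm.trans h) h₈, fun _ => h₇⟩
  case deqMissed h =>
    obtain ⟨rfl, hp, q, h₁, h₂, h₃, h₄, h₅, h₆, h₇⟩ := ha
    exact ⟨harg, hx, hp, q, h₁, h₂, h₆ h, h₄, h₅⟩
  case deqReady h =>
    obtain ⟨rfl, hp, q, h₁, h₂, h₃, h₄, h₅, h₆, h₇⟩ := ha
    exact ⟨harg, hx, rfl, hp, q, h₁, h₂, h₃, h₄, h₅, h, h₇ h⟩
  case deqMissed' h =>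
    obtain ⟨rfl, hp, q, h₁, h₂, h₃, h₄, h₅, h₆, h₇⟩ := ha
    refine ⟨harg, hx, hp, q, h₁, h₂, ?_, h₄, h₅⟩
    by_contra hq
    rw [h₅, addr, Option.getD_some, hm.item q (by omega) (by omega)] at h
    exact h h₇.symm
  case swappedFail h =>
    obtain ⟨k, h₁, h₂, h₃, h₄, h₅, h₆⟩ := ha
    refine ⟨harg, hx, k, h₁, h₆, .inr ⟨h₂, ?_⟩⟩
    by_contra hk
    obtain rfl : k = G.hd := by omega
    exact h (hm.head.trans h₃.symm)
  case missedFail => exact ⟨harg, hx, ha.1⟩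

end Basic

/-- The knowledge of thread `u` survives a step of another thread. -/
structure Ext (G : Ghost V T) (g : Shared V) (G' : Ghost V T) (g' : Shared V) (u : T) : Prop where
  m : G.m ≤ G'.m
  tl : G.tl ≤ G'.tl
  hd : G.hd ≤ G'.hd
  sw : G.sw ≤ G'.sw
  a : ∀ k ≤ G.m, G'.a k = G.a k
  ty : ∀ k ≤ G.m, G'.ty k = G.ty k
  val : ∀ k < G.m, G'.val k = G.val k
  S : ∀ k < G.sw, G'.S k = G.S k
  role : G'.role u = G.role u
  pre : ∀ i o, Pre G g i u o → Pre G' g' i u o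

/-! ### Freedom from interference, and growth of the trace. -/

section Steps

variable {env : T → Option (QInv V)} {G G' : Ghost V T} {g g' : Shared V} {i : QInv V} {t : T}
  {l l' : Loc V} {pc pc' : PC} {k : ℕ}
  {τ : List (T × Label (QInv V) (Option V) Act Tst)} {ℓ : Label (QInv V) (Option V) Act Tst}
  {th : T → Option (Loc V × Option (Kat Act Tst))}

/-- The assertions bound indices only by counters that grow, and otherwise mention only entries of
the history that are already fixed, the thread's own role, and its private node; no other thread can
invalidate them. -/
theorem At.ext (ha : At G g i t l pc) (hm : Mem G g) (e : Ext G g G' g' t) :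
    At G' g' i t l pc := by
  have := hm.hd_le
  have := hm.sw_le_hd
  have := hm.sw_le
  have := hm.tl_le
  have := e.m
  have := e.tl
  have := e.hd
  have := e.sw
  have hser : Served G i t l → Served G' i t l := by
    rintro ⟨k, h₁, h₂, h₃⟩
    refine ⟨k, by omega, by rwa [e.S k h₁], ?_⟩
    rw [e.role]
    exact h₃.imp_right fun h => ⟨h.1, by omega⟩
  cases pc
  case start => exact e.role.trans ha
  case loop => exact e.pre _ _ ha
  case gotTail =>
    obtain ⟨hp, p, h₁, h₂⟩ := ha
    exact ⟨e.pre _ _ hp, p, by omega, by rw [e.a p (by omega), h₂]⟩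
  case gotHead | differ =>
    obtain ⟨hp, p, h₁, h₂, q, h₃, h₄⟩ := ha
    exact ⟨e.pre _ _ hp, p, by omega, by rw [e.a p (by omega), h₂], q, by omega,
      by rw [e.a q (by omega), h₄]⟩
  case differ' =>
    obtain ⟨hp, p, h₁, h₂, q, h₃, h₄, h₅⟩ := ha
    exact ⟨e.pre _ _ hp, p, by omega, by rw [e.a p (by omega), h₂], q, by omega,
      by rw [e.a q (by omega), h₄], h₅⟩
  case append =>
    obtain ⟨hp, p, h₁, h₂, h₃⟩ := ha
    exact ⟨e.pre _ _ hp, p, by omega, by rw [e.a p (by omega), h₂],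
      by rw [e.ty p (by omega)]; exact h₃.imp_right e.hd.trans'⟩
  case appendNext | appendChecked =>
    obtain ⟨hp, p, h₁, h₂, h₃, h₄⟩ := ha
    refine ⟨e.pre _ _ hp, p, by omega, by rw [e.a p (by omega), h₂],
      by rw [e.ty p (by omega)]; exact h₃.imp_right e.hd.trans', h₄.imp_right ?_⟩
    rintro ⟨h₅, h₆⟩
    exact ⟨by omega, by rw [e.a _ (by omega), h₆]⟩
  case tailCas =>
    obtain ⟨hp, p, h₁, h₂, h₃, h₄, h₅⟩ := ha
    exact ⟨e.pre _ _ hp, p, by omega, by rw [e.a p (by omega), h₂],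
      by rw [e.ty p (by omega)]; exact h₃.imp_right e.hd.trans', by omega, by rw [e.a _ (by omega), h₅]⟩
  case linkCas =>
    obtain ⟨hp, p, h₁, h₂, h₃, h₄⟩ := ha
    exact ⟨e.pre _ _ hp, p, by omega, by rw [e.a p (by omega), h₂],
      by rw [e.ty p (by omega)]; exact h₃.imp_right e.hd.trans', h₄⟩
  case linked =>
    obtain ⟨k, h₁, h₂, h₃, h₄, h₅⟩ := ha
    exact ⟨k, by omega, e.role.trans h₂, by rw [e.a _ (by omega), h₃],
      by rw [e.a _ (by omega), h₄], by omega⟩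
  case wait | waiting | woken | finish =>
    obtain ⟨k, h₁, h₂, h₃⟩ := ha
    exact ⟨k, by omega, e.role.trans h₂, by rw [e.a _ (by omega), h₃]⟩
  case wokenHead =>
    obtain ⟨k, h₁, h₂, h₃, q, h₄, h₅⟩ := ha
    exact ⟨k, by omega, e.role.trans h₂, by rw [e.a _ (by omega), h₃], q, by omega,
      by rw [e.a _ (by omega), h₅]⟩
  case headCas =>
    obtain ⟨k, h₁, h₂, h₃, h₄⟩ := ha
    exact ⟨k, by omega, e.role.trans h₂, by rw [e.a _ (by omega), h₃],
      by rw [e.a _ (by omega), h₄]⟩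
  case swap =>
    obtain ⟨hp, p, h₁, h₂, h₃, q, h₄, h₅, h₆⟩ := ha
    exact ⟨e.pre _ _ hp, p, by omega, by rw [e.a p (by omega), h₂], by rwa [e.ty p (by omega)],
      q, by omega, by rw [e.a q (by omega), h₅], h₆⟩
  case swapNext =>
    obtain ⟨hp, p, h₁, h₂, h₃, q, h₄, h₅, h₆, h₇⟩ := ha
    refine ⟨e.pre _ _ hp, p, by omega, by rw [e.a p (by omega), h₂], by rwa [e.ty p (by omega)],
      q, by omega, by rw [e.a q (by omega), h₅], h₆, h₇.imp_right ?_⟩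
    rintro ⟨h₈, h₉⟩
    exact ⟨by omega, by rw [e.a _ (by omega), h₉]⟩
  case swapTail =>
    obtain ⟨hp, p, h₁, h₃, q, h₄, h₅, h₆, h₇⟩ := ha
    exact ⟨e.pre _ _ hp, p, by omega, by rwa [e.ty p (by omega)],
      q, by omega, by rw [e.a q (by omega), h₅], h₆, by rwa [e.a _ (by omega)]⟩
  case swapHead =>
    obtain ⟨hp, q, h₁, h₂, h₃, h₄, h₅⟩ := ha
    exact ⟨e.pre _ _ hp, q, by omega, by rw [e.a q (by omega), h₂], by omega,
      by rwa [e.ty _ (by omega)], by rwa [e.a _ (by omega)]⟩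
  case swapReady =>
    obtain ⟨hp, q, h₁, h₂, h₃, h₄, h₅⟩ := ha
    exact ⟨e.pre _ _ hp, q, by omega, by rw [e.a q (by omega), h₂], by omega,
      by rwa [e.ty _ (by omega)], by rwa [e.a _ (by omega)]⟩
  case swapItem =>
    obtain ⟨hi, hp, q, h₁, h₂, h₃, h₄, h₅, h₆, h₇⟩ := ha
    exact ⟨hi, e.pre _ _ hp, q, by omega, by rw [e.a q (by omega), h₂], by omega,
      by rwa [e.ty _ (by omega)], by rwa [e.a _ (by omega)], fun h => (h₆ h).trans_le e.sw,
      by rwa [e.val _ (by omega)]⟩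
  case swapCas =>
    obtain ⟨hi, hp, q, h₁, h₂, h₃, h₄, h₅, h₆, h₇⟩ := ha
    exact ⟨hi, e.pre _ _ hp, q, by omega, by rw [e.a q (by omega), h₂], by omega,
      by rwa [e.ty _ (by omega)], by rwa [e.a _ (by omega)], h₆, by rwa [e.val _ (by omega)]⟩
  case swapped =>
    obtain ⟨k, h₁, h₂, h₃, h₄, h₅, h₆⟩ := ha
    exact ⟨k, by omega, e.role.trans h₂, by rw [e.a _ (by omega), h₃],
      by rw [e.a _ (by omega), h₄], by rwa [e.ty _ (by omega)], by rwa [e.S k h₁]⟩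
  case missed =>
    obtain ⟨hp, q, h₁, h₂, h₃, h₄, h₅⟩ := ha
    exact ⟨e.pre _ _ hp, q, by omega, by rw [e.a q (by omega), h₂], by omega,
      by rwa [e.ty _ (by omega)], by rwa [e.a _ (by omega)]⟩
  case atRet | returned => exact hser ha

variable [DecidableEq T]

theorem Inv.idle_update (hI : Inv env G τ g th) {x : Loc V × Option (Kat Act Tst)}
    (hrole : ∀ u ≠ t, G'.role u = G.role u) (u : T)
    (hu : Function.update th t (some x) u = none) : G'.role u = .free := by
  rcases eq_or_ne u t with rfl | hut
  · simp at hu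
  · rw [Function.update_of_ne hut] at hu
    rw [hrole u hut, hI.idle u hu]

theorem Inv.thread_update (hI : Inv env G τ g th) {l' : Loc V} {r : Option (Kat Act Tst)}
    (hext : ∀ u ≠ t, Ext G g G' g' u) (hok : ThreadOK env G' g' t l' r) (u : T) (l : Loc V)
    (k : Option (Kat Act Tst)) (hu : Function.update th t (some (l', r)) u = some (l, k)) :
    ThreadOK env G' g' u l k := by
  rcases eq_or_ne u t with rfl | hut
  · rw [Function.update_self] at hu
    obtain ⟨rfl, rfl⟩ := Prod.ext_iff.1 (Option.some.inj hu)
    exact hok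
  · rw [Function.update_of_ne hut] at hu
    obtain ⟨i, pc, h₁, h₂, h₃, h₄, h₅⟩ := hI.thread u l k hu
    exact ⟨i, pc, h₁, h₂, h₃, h₄, h₅.ext hI.mem (hext u hut)⟩

/-- A newly exchanged block gets the position of the present step, which is later than all recorded
positions and invocations; `hnew` demands that its participants have not returned. -/
theorem Hist.step (hH : Hist env G τ th) {x : Loc V × Option (Kat Act Tst)}
    (hth : th t ≠ none) (hℓ : ∀ i, ℓ ≠ .inv i) (hsw : G.sw ≤ G'.sw)
    (hS : ∀ k < G.sw, G'.S k = G.S k ∧ G'.pos k = G.pos k)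
    (hrole : ∀ k < G.sw, ∀ u, G'.role u = .app k ∨ G'.role u = .swp k →
      G.role u = .app k ∨ G.role u = .swp k)
    (hnew : ∀ k, G.sw ≤ k → k < G'.sw → G'.pos k = τ.length ∧
      ∀ u, G'.role u = .app k ∨ G'.role u = .swp k → ∀ r, (u, .ret r) ∉ τ ++ [(t, ℓ)])
    (hret : ∀ r, ℓ = .ret r → ∃ i, ∃ k < G.sw, (t, i, r) ∈ G.S k) :
    Hist env G' (τ ++ [(t, ℓ)]) (Function.update th t (some x)) := by
  have hinv : ∀ (j : ℕ) u i, (τ ++ [(t, ℓ)])[j]? = some (u, .inv i) →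
      τ[j]? = some (u, .inv i) ∧ j < τ.length := by
    intro j u i hj
    rcases lt_or_ge j τ.length with h | h
    · exact ⟨by rwa [List.getElem?_append_left h] at hj, h⟩
    · rw [List.getElem?_append_right h] at hj
      have := List.mem_of_getElem? hj
      simp only [List.mem_singleton, Prod.mk.injEq] at this
      exact absurd this.2.symm (hℓ i)
  constructor
  · intro u hu ℓ' h
    rcases eq_or_ne u t with rfl | hut
    · simp at hu
    · rw [Function.update_of_ne hut] at hu
      have := hH.idle u hu ℓ'
      simp_all
  · intro u hu i hi
    refine List.mem_append_left _ (hH.invoked u ?_ i hi)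
    rcases eq_or_ne u t with rfl | hut
    · exact hth
    · rwa [Function.update_of_ne hut] at hu
  · intro u r h
    obtain ⟨i, k, hk, h⟩ : ∃ i, ∃ k < G.sw, (u, i, r) ∈ G.S k := by
      rcases List.mem_append.1 h with h | h
      · exact hH.returned u r h
      · obtain ⟨rfl, h'⟩ : u = t ∧ .ret r = ℓ := by simpa using h
        exact hret r h'.symm
    exact ⟨i, k, by omega, by rwa [(hS k hk).1]⟩
  · intro u _ j i hj
    have := (hinv j u i hj).2
    simpa using this
  · intro k hk
    rw [List.length_append, List.length_singleton]
    rcases lt_or_ge k G.sw with h | h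
    · have := hH.pos_lt k h
      rw [(hS k h).2]
      omega
    · rw [(hnew k h hk).1]
      omega
  · intro j k hjk hk
    rcases lt_or_ge k G.sw with h | h
    · rw [(hS k h).2, (hS j (by omega)).2]
      exact hH.mono j k hjk h
    · rw [(hnew k h hk).1]
      rcases lt_or_ge j G.sw with h' | h'
      · rw [(hS j h').2]
        exact (hH.pos_lt j h').le
      · rw [(hnew j h' (by omega)).1]
  · intro k hk u hu j i hj
    obtain ⟨h₁, h₂⟩ := hinv j u i hj
    rcases lt_or_ge k G.sw with h | h
    · rw [(hS k h).2]
      exact hH.pos_inv k h u (hrole k h u hu) j i h₁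
    · rwa [(hnew k h hk).1]
  · intro k hk u hu j r hj
    rcases lt_or_ge k G.sw with h | h
    · rw [(hS k h).2]
      rcases lt_or_ge j τ.length with h' | h'
      · rw [List.getElem?_append_left h'] at hj
        exact hH.pos_ret k h u (hrole k h u hu) j r hj
      · exact (hH.pos_lt k h).trans_le h'
    · exact absurd (List.mem_of_getElem? hj) ((hnew k h hk).2 u hu r)

theorem Hist.step_of_sw_eq (hH : Hist env G τ th) {x : Loc V × Option (Kat Act Tst)}
    (hth : th t ≠ none) (hℓ : ∀ i, ℓ ≠ .inv i) (hsw : G'.sw = G.sw)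
    (hS : ∀ k < G.sw, G'.S k = G.S k) (hpos : G'.pos = G.pos)
    (hrole : ∀ k < G.sw, ∀ u, G'.role u = .app k ∨ G'.role u = .swp k →
      G.role u = .app k ∨ G.role u = .swp k)
    (hret : ∀ r, ℓ = .ret r → ∃ i, ∃ k < G.sw, (t, i, r) ∈ G.S k) :
    Hist env G' (τ ++ [(t, ℓ)]) (Function.update th t (some x)) :=
  hH.step hth hℓ hsw.ge (fun k hk => ⟨hS k hk, by rw [hpos]⟩) hrole
    (fun k h₁ h₂ => by omega) hret

/-- A step without effect on the shared memory. -/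
theorem Inv.quiet (hI : Inv env G τ g th) {r : Option (Kat Act Tst)} (hth : th t ≠ none)
    (hi : env t = some i) (hy : layerOf i ℓ = none) (hℓ : ∀ i, ℓ ≠ .inv i)
    (hret : ∀ r, ℓ = .ret r → ∃ i, ∃ k < G.sw, (t, i, r) ∈ G.S k)
    (hok : ThreadOK env G g t l' r) :
    Inv env G (τ ++ [(t, ℓ)]) g (Function.update th t (some (l', r))) where
  mem := hI.mem
  block := hI.block
  blockWrites := hI.blockWrites
  idle := hI.idle_update fun _ _ => rfl
  thread := hI.thread_update (fun _ _ => ⟨le_rfl, le_rfl, le_rfl, le_rfl, fun _ _ => rfl,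
    fun _ _ => rfl, fun _ _ => rfl, fun _ _ => rfl, rfl, fun _ _ h => h⟩) hok
  hist := hI.hist.step_of_sw_eq hth hℓ rfl (fun _ _ => rfl) rfl (fun _ _ _ h => h) hret
  writes := by rw [writes_append_of_none hi hy]; exact hI.writes

/-- The invoking thread is still free, so the positions of invocations that matter to blocks do not
change. -/
theorem Inv.invoke (hI : Inv env G τ g th) (hth : th t = none) (hi : env t = some i)
    (hok : ThreadOK env G g t l' (PC.start.code i)) :
    Inv env G (τ ++ [(t, .inv i)]) g (Function.update th t (some (l', PC.start.code i))) where
  mem := hI.mem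
  block := hI.block
  blockWrites := hI.blockWrites
  idle := hI.idle_update fun _ _ => rfl
  thread := hI.thread_update (fun _ _ => ⟨le_rfl, le_rfl, le_rfl, le_rfl, fun _ _ => rfl,
    fun _ _ => rfl, fun _ _ => rfl, fun _ _ => rfl, rfl, fun _ _ h => h⟩) hok
  writes := by
    rw [writes_append_of_none hi (by cases i <;> rfl)]
    exact hI.writes
  hist := by
    have hH := hI.hist
    have hfree := hI.idle t hth
    have hold : ∀ (j : ℕ) u i', G.role u ≠ .free →
        (τ ++ [(t, Label.inv i)])[j]? = some (u, .inv i') → τ[j]? = some (u, .inv i') := by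
      intro j u i' hu hj
      rcases lt_or_ge j τ.length with h | h
      · rwa [List.getElem?_append_left h] at hj
      · rw [List.getElem?_append_right h] at hj
        have := List.mem_of_getElem? hj
        simp only [List.mem_singleton, Prod.mk.injEq] at this
        exact absurd (this.1 ▸ hfree) hu
    have hne : ∀ u k, G.role u = .app k ∨ G.role u = .swp k → G.role u ≠ .free := by
      rintro u k (h | h) <;> simp [h]
    constructor
    · intro u hu ℓ' h
      rcases eq_or_ne u t with rfl | hut
      · simp at hu
      · rw [Function.update_of_ne hut] at hu
        have := hH.idle u hu ℓ'
        simp_all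
    · intro u hu i' hi'
      rcases eq_or_ne u t with rfl | hut
      · simp_all
      · rw [Function.update_of_ne hut] at hu
        exact List.mem_append_left _ (hH.invoked u hu i' hi')
    · intro u r h
      exact hH.returned u r (by simpa using h)
    · intro u hu j i' hj
      have := hH.inv_lt u hu j i' (hold j u i' hu hj)
      rw [List.length_append, List.length_singleton]
      omega
    · intro k hk
      have := hH.pos_lt k hk
      rw [List.length_append]
      omega
    · exact hH.mono
    · intro k hk u hu j i' hj
      exact hH.pos_inv k hk u hu j i' (hold j u i' (hne u k hu) hj)
    · intro k hk u hu j r hj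
      refine hH.pos_ret k hk u hu j r ?_
      rcases lt_or_ge j τ.length with h | h
      · rwa [List.getElem?_append_left h] at hj
      · rw [List.getElem?_append_right h] at hj
        have := List.mem_of_getElem? hj
        simp at this

end Steps

theorem Shared.setNode_node_self (g : Shared V) (p : ℕ) (v : Node V) :
    (g.setNode p v).node p = v := by simp [setNode]

theorem Shared.setNode_node_ne (g : Shared V) {p q : ℕ} (v : Node V) (h : q ≠ p) :
    (g.setNode p v).node q = g.node q := by simp [setNode, h]

theorem eq_arw_of_layerOf {i : QInv V} {ℓ : Label (QInv V) (Option V) Act Tst} {y : Layer}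
    (h : layerOf i ℓ = some y) : ∃ b a, ℓ = .arw b a := by
  cases ℓ <;> cases i <;> simp_all [layerOf]

/-! ### Steps that write to the shared memory. -/

section Steps

variable {env : T → Option (QInv V)} {G G' : Ghost V T} {g g' : Shared V} {i : QInv V} {t : T}
  {l l' : Loc V} {pc pc' : PC} {k : ℕ}
  {τ : List (T × Label (QInv V) (Option V) Act Tst)} {ℓ : Label (QInv V) (Option V) Act Tst}
  {th : T → Option (Loc V × Option (Kat Act Tst))} {r : Option (Kat Act Tst)}

/-- For blocks that a step does not concern. Threads with a role never change it, and the item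
matters only once it has been exchanged; before that it is governed by `Mem.item`. -/
theorem Block.ext (hb : Block env G g k) (hsw : G'.sw ≤ k ↔ G.sw ≤ k)
    (hrole : ∀ u, G.role u ≠ .free → G'.role u = G.role u) (hty : G'.ty (k + 1) = G.ty (k + 1))
    (hval : G'.val k = G.val k) (hS : G'.S k = G.S k)
    (hitem : k < G.sw → (g'.node (G'.a (k + 1))).item = (g.node (G.a (k + 1))).item) :
    Block env G' g' k := by
  have hlt : k < G'.sw ↔ k < G.sw := by omega
  have happ : ∀ u, G.role u = .app k → G'.role u = .app k := fun u h =>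
    (hrole u (by simp [h])).trans h
  have hswp : ∀ u, G.role u = .swp k → G'.role u = .swp k := fun u h =>
    (hrole u (by simp [h])).trans h
  cases hb with
  | item t v h₁ h₂ h₃ h₄ h₅ h₆ =>
    exact .item t v (hsw.2 h₁) (happ t h₂) h₃ (hty.trans h₄) (hval.trans h₅) (hS.trans h₆)
  | reservation t h₁ h₂ h₃ h₄ h₅ h₆ =>
    exact .reservation t (hsw.2 h₁) (happ t h₂) h₃ (hty.trans h₄) (hval.trans h₅) (hS.trans h₆)
  | taken t u v h₁ h₂ h₃ h₄ h₅ h₆ h₇ h₈ h₉ =>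
    exact .taken t u v (hlt.2 h₁) (happ t h₂) h₃ (hswp u h₄) h₅ (hty.trans h₆) (hval.trans h₇)
      ((hitem h₁).trans h₈) (hS.trans h₉)
  | filled t u v h₁ h₂ h₃ h₄ h₅ h₆ h₇ h₈ h₉ =>
    exact .filled t u v (hlt.2 h₁) (happ t h₂) h₃ (hswp u h₄) h₅ (hty.trans h₆) (hval.trans h₇)
      ((hitem h₁).trans h₈) (hS.trans h₉)

def Ghost.tailStep (G : Ghost V T) (t : T) : Ghost V T :=
  { G with
    tl := G.tl + 1
    W := Function.update G.W G.tl (G.W G.tl ++ [(t, .TA)]) }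

theorem Mem.tailStep (hm : Mem G g) (htl : G.tl < G.m) :
    Mem (G.tailStep t) { g with tail := G.a (G.tl + 1) } :=
  { hm with
    sw_le := hm.sw_le.trans (Nat.le_succ _)
    tl_le := htl
    le_tl := hm.le_tl.trans (Nat.le_succ _)
    tail := rfl }

theorem Ext.tailStep (u : T) :
    Ext G g (G.tailStep t) { g with tail := G.a (G.tl + 1) } u :=
  ⟨le_rfl, Nat.le_succ _, le_rfl, le_rfl, fun _ _ => rfl, fun _ _ => rfl, fun _ _ => rfl,
    fun _ _ => rfl, rfl, fun _ _ h => ⟨h.1, h.2, h.3, h.4, h.5⟩⟩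

def Ghost.headStep (G : Ghost V T) (t : T) : Ghost V T :=
  { G with
    hd := G.hd + 1
    W := Function.update G.W G.hd (G.W G.hd ++ [(t, .HR)]) }

theorem Mem.headStep (hm : Mem G g) (hhd : G.hd < G.sw) :
    Mem (G.headStep t) { g with head := G.a (G.hd + 1) } :=
  { hm with
    hd_le := hhd
    sw_le_hd := hm.sw_le_hd.trans (Nat.le_succ _)
    head := rfl
    same := fun j k h₁ h₂ h₃ h₄ => hm.same j k ((Nat.le_succ _).trans h₁) h₂
      ((Nat.le_succ _).trans h₃) h₄ }

theorem Ext.headStep (u : T) :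
    Ext G g (G.headStep t) { g with head := G.a (G.hd + 1) } u :=
  ⟨le_rfl, le_rfl, Nat.le_succ _, le_rfl, fun _ _ => rfl, fun _ _ => rfl, fun _ _ => rfl,
    fun _ _ => rfl, rfl, fun _ _ h => ⟨h.1, h.2, h.3, h.4, h.5⟩⟩

/-- Blocks beyond the head have not been exchanged after block `hd`, so later blocks contain only
appends and `TA`. By `writer`, a write of `t` in block `j > hd` would contradict the role `app hd`,
or would need `t` to be the appender of block `j` or `a j` to have the type of `t`. In the second
case of `hw` there is no such role, and `a j` has the opposite type since all nodes beyond the head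
agree. -/
theorem Inv.later_writes (hI : Inv env G τ g th) (hi : env t = some i) (hlt : G.hd < G.m)
    (hw : G.role t = .app G.hd ∨ (∀ j, G.role t ≠ .app j) ∧ G.ty (G.hd + 1) ≠ tyOf i)
    (j : ℕ) (hj : G.hd < j) (hjm : j < G.m) (x : T × Layer) (hx : x ∈ G.W j) :
    x.1 ≠ t ∧ x.2.TailSide := by
  have hm := hI.mem
  have := hm.sw_le_hd
  obtain ⟨h₁, h₂⟩ := hI.blockWrites j hjm
  have hx' : x.2.TailSide := by
    have : x.2 ∈ (G.W j).map Prod.snd := List.mem_map_of_mem hx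
    rw [h₁, letters, if_neg (show ¬ j < G.sw by omega), if_neg (show ¬ j < G.hd by omega)] at this
    have : x.2 = appendLayer (G.ty (j + 1)) ∨ x.2 = .TA := by
      split_ifs at this <;> simp_all
    rcases this with h | h <;> rw [h]
    · cases G.ty (j + 1) <;> trivial
    · trivial
  refine ⟨?_, hx'⟩
  rintro rfl
  obtain ⟨h₃, h₄⟩ := h₂ x hx hx'
  rcases hw with hw | ⟨hw, hty⟩
  · have := h₃ _ hw
    omega
  · rcases h₄ with h₄ | ⟨i', hi', h₄⟩ | h₄
    · exact hw j h₄
    · obtain rfl := Option.some.inj (hi.symm.trans hi')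
      obtain ⟨j, rfl⟩ : ∃ j', j = j' + 1 := ⟨j - 1, by omega⟩
      exact hty (by rw [hm.same G.hd j le_rfl hlt (by omega) (by omega), h₄])
    · omega

variable [DecidableEq T]

/-! #### Allocation -/

def Ghost.alloc (G : Ghost V T) (t : T) (p : ℕ) : Ghost V T :=
  { G with own := Function.update G.own p (some t) }

theorem Inv.alloc (hI : Inv env G τ g th) (hth : th t ≠ none) (hi : env t = some i) (a : Act)
    (v : Node V)
    (hok : ThreadOK env (G.alloc t g.size) { g.setNode g.size v with size := g.size + 1 } t l' r) :
    Inv env (G.alloc t g.size) (τ ++ [(t, .act a)]) { g.setNode g.size v with size := g.size + 1 }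
      (Function.update th t (some (l', r))) := by
  have hm := hI.mem
  have hne : ∀ k ≤ G.m, G.a k ≠ g.size := fun k hk => (hm.lt_size k hk).ne
  have hnode : ∀ k ≤ G.m, (g.setNode g.size v).node (G.a k) = g.node (G.a k) := fun k hk =>
    g.setNode_node_ne v (hne k hk)
  exact {
    mem := {
      hm with
      lt_size := fun k hk => (hm.lt_size k hk).trans (Nat.lt_succ_self _)
      next := fun k hk => by simpa only [Ghost.alloc, hnode k hk.le] using hm.next k hk
      last := by simpa only [Ghost.alloc, hnode G.m le_rfl] using hm.last
      type := fun k hk => by simpa only [Ghost.alloc, hnode k hk] using hm.type k hk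
      item := fun k hk hkm => by
        simpa only [Ghost.alloc, hnode (k + 1) hkm] using hm.item k hk hkm
      app := fun u k hu => by
        obtain ⟨h₁, h₂⟩ := hm.app u k hu
        exact ⟨h₁, by simpa only [Ghost.alloc, Function.update_of_ne (hne (k + 1) h₁)] using h₂⟩ }
    block := fun k hk => (hI.block k hk).ext Iff.rfl (fun _ _ => rfl) rfl rfl rfl fun _ => by
      simp only [Ghost.alloc, hnode (k + 1) hk]
    blockWrites := fun k hk => { hI.blockWrites k hk with }
    idle := hI.idle_update fun _ _ => rfl
    thread := hI.thread_update (fun u hu => {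
      m := le_rfl
      tl := le_rfl
      hd := le_rfl
      sw := le_rfl
      a := fun _ _ => rfl
      ty := fun _ _ => rfl
      val := fun _ _ => rfl
      S := fun _ _ => rfl
      role := rfl
      pre := fun i o h => ⟨h.role, by simpa only [Ghost.alloc, Function.update_of_ne h.lt.ne]
        using h.own, h.lt.trans (Nat.lt_succ_self _), h.ne,
        (g.setNode_node_ne v h.lt.ne).trans h.node⟩ }) hok
    hist := hI.hist.step_of_sw_eq hth (fun _ => nofun) rfl (fun _ _ => rfl) rfl
      (fun _ _ _ h => h) (fun _ => nofun)
    writes := by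
      rw [writes_append_of_none hi (by cases i <;> rfl)]
      exact hI.writes }

/-! #### Advancing the tail -/

/-- As `m ≤ tl + 1`, block `tl` is the last one and the new `TA` has nothing to pass. -/
theorem Inv.tailStep (hI : Inv env G τ g th) (hth : th t ≠ none) (hi : env t = some i)
    (hy : layerOf i ℓ = some .TA) (htl : G.tl < G.m)
    (hw : (∀ j, G.role t = .app j → G.tl ≤ j) ∧
      (G.role t = .app G.tl ∨ (∃ i, env t = some i ∧ G.ty G.tl = tyOf i) ∨ G.tl ≤ G.hd))
    (hok : ThreadOK env (G.tailStep t) { g with tail := G.a (G.tl + 1) } t l' r) :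
    Inv env (G.tailStep t) (τ ++ [(t, ℓ)]) { g with tail := G.a (G.tl + 1) }
      (Function.update th t (some (l', r))) := by
  have hm := hI.mem
  have := hm.hd_le
  have := hm.sw_le
  have := hm.le_tl
  obtain ⟨b, a, rfl⟩ := eq_arw_of_layerOf hy
  refine {
    mem := hm.tailStep htl
    block := fun k hk => (hI.block k hk).ext Iff.rfl (fun _ _ => rfl) rfl rfl rfl fun _ => rfl
    blockWrites := fun k hk => ?_
    idle := hI.idle_update fun _ _ => rfl
    thread := hI.thread_update (fun u _ => Ext.tailStep u) hok
    hist := hI.hist.step_of_sw_eq hth (fun _ => nofun) rfl (fun _ _ => rfl) rfl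
      (fun _ _ _ h => h) (fun _ => nofun)
    writes := ?_ }
  · obtain ⟨h₁, h₂⟩ := hI.blockWrites k hk
    rcases eq_or_ne k G.tl with rfl | hk'
    · refine ⟨?_, fun x hx hx' => ?_⟩
      · simp only [Ghost.tailStep, Function.update_self, List.map_append, h₁]
        simp [letters, not_lt.2 hm.sw_le, not_lt.2 (hm.hd_le.trans hm.sw_le)]
      · simp only [Ghost.tailStep, Function.update_self, List.mem_append,
          List.mem_singleton] at hx
        rcases hx with hx | rfl
        exacts [h₂ x hx hx', hw]
    · refine ⟨?_, fun x hx hx' => ?_⟩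
      · simp only [Ghost.tailStep, Function.update_of_ne hk', h₁, letters,
          show (k < G.tl + 1 ↔ k < G.tl) by omega]
        congr!
      · simp only [Ghost.tailStep, Function.update_of_ne hk'] at hx
        exact h₂ x hx hx'
  · rw [writes_append_of_some hi hy]
    exact (exchanges_append_right hI.writes _).trans
      (exchanges_insert G.W (t, .TA) htl fun j h₁ h₂ => by omega)

/-! #### Writes on the head side -/

/-- The two cases of `hw` are the woken appender of the node, and a thread of the opposite type that
exchanged the item or found it already exchanged. -/
theorem Inv.headStep (hI : Inv env G τ g th) (hth : th t ≠ none) (hi : env t = some i)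
    (hy : layerOf i ℓ = some .HR) (hhd : G.hd < G.sw)
    (hw : G.role t = .app G.hd ∨ (∀ j, G.role t ≠ .app j) ∧ G.ty (G.hd + 1) ≠ tyOf i)
    (hok : ThreadOK env (G.headStep t) { g with head := G.a (G.hd + 1) } t l' r) :
    Inv env (G.headStep t) (τ ++ [(t, ℓ)]) { g with head := G.a (G.hd + 1) }
      (Function.update th t (some (l', r))) := by
  have hm := hI.mem
  have := hm.hd_le
  have := hm.sw_le
  have := hm.tl_le
  obtain ⟨b, a, rfl⟩ := eq_arw_of_layerOf hy
  refine {
    mem := hm.headStep hhd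
    block := fun k hk => (hI.block k hk).ext Iff.rfl (fun _ _ => rfl) rfl rfl rfl fun _ => rfl
    blockWrites := fun k hk => ?_
    idle := hI.idle_update fun _ _ => rfl
    thread := hI.thread_update (fun u _ => Ext.headStep u) hok
    hist := hI.hist.step_of_sw_eq hth (fun _ => nofun) rfl (fun _ _ => rfl) rfl
      (fun _ _ _ h => h) (fun _ => nofun)
    writes := ?_ }
  · obtain ⟨h₁, h₂⟩ := hI.blockWrites k hk
    have hmono : ∀ x ∈ G.W k, x.2.TailSide → (∀ j, G.role x.1 = .app j → k ≤ j) ∧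
        (G.role x.1 = .app k ∨ (∃ i, env x.1 = some i ∧ G.ty k = tyOf i) ∨ k ≤ G.hd + 1) := by
      intro x hx hx'
      obtain ⟨h₃, h₄⟩ := h₂ x hx hx'
      exact ⟨h₃, h₄.imp_right fun h => h.imp_right fun h => h.trans (Nat.le_succ _)⟩
    rcases eq_or_ne k G.hd with rfl | hk'
    · refine ⟨?_, fun x hx hx' => ?_⟩
      · simp only [Ghost.headStep, Function.update_self, List.map_append, h₁]
        simp [letters]
      · simp only [Ghost.headStep, Function.update_self, List.mem_append,
          List.mem_singleton] at hx
        rcases hx with hx | rfl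
        exacts [hmono x hx hx', hx'.elim]
    · refine ⟨?_, fun x hx hx' => ?_⟩
      · simp only [Ghost.headStep, Function.update_of_ne hk', h₁, letters,
          show (k < G.hd + 1 ↔ k < G.hd) by omega]
        congr!
      · simp only [Ghost.headStep, Function.update_of_ne hk'] at hx
        exact hmono x hx hx'
  · rw [writes_append_of_some hi hy]
    refine (exchanges_append_right hI.writes _).trans
      (exchanges_insert G.W (t, .HR) (show G.hd < G.m by omega) fun j h₁ h₂ x hx => ?_)
    obtain ⟨h₃, h₄⟩ := hI.later_writes hi (by omega) hw j h₁ h₂ x hx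
    exact ⟨h₃, h₄, trivial⟩

/-! #### Exchanging an item -/

/-- The position `n` of the exchange in the trace becomes the linearization point of both operations
`s` of the block. -/
def Ghost.swapStep (G : Ghost V T) (t : T) (s : List (T × QInv V × Option V)) (n : ℕ) :
    Ghost V T :=
  { G with
    sw := G.sw + 1
    role := Function.update G.role t (.swp G.sw)
    W := Function.update G.W G.sw (G.W G.sw ++ [(t, swapLayer (G.ty (G.sw + 1)))])
    S := Function.update G.S G.sw s
    pos := Function.update G.pos G.sw n }

theorem Inv.swapStep (hI : Inv env G τ g th) (hth : th t ≠ none) (hi : env t = some i)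
    (hy : layerOf i ℓ = some (swapLayer (G.ty (G.sw + 1)))) (hhd : G.hd = G.sw)
    (hsw : G.sw < G.tl) (hrole : G.role t = .free) (hty : G.ty (G.sw + 1) ≠ tyOf i)
    {s : List (T × QInv V × Option V)} {v : Node V}
    (hv : v.type = (g.node (G.a (G.sw + 1))).type ∧ v.next = (g.node (G.a (G.sw + 1))).next)
    (hblock : Block env (G.swapStep t s τ.length) (g.setNode (G.a (G.sw + 1)) v) G.sw)
    (hok : ThreadOK env (G.swapStep t s τ.length) (g.setNode (G.a (G.sw + 1)) v) t l' r) :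
    Inv env (G.swapStep t s τ.length) (τ ++ [(t, ℓ)]) (g.setNode (G.a (G.sw + 1)) v)
      (Function.update th t (some (l', r))) := by
  have hm := hI.mem
  have := hm.tl_le
  obtain ⟨b, a, rfl⟩ := eq_arw_of_layerOf hy
  have hnt : ∀ u, G.role u ≠ .free → u ≠ t := by
    rintro u hu rfl
    exact hu hrole
  have hrole' : ∀ u ≠ t, (G.swapStep t s τ.length).role u = G.role u := fun u hu =>
    Function.update_of_ne hu _ _
  have hself : (G.swapStep t s τ.length).role t = .swp G.sw := Function.update_self ..
  have hnode : ∀ k ≤ G.m, k ≠ G.sw + 1 →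
      (g.setNode (G.a (G.sw + 1)) v).node (G.a k) = g.node (G.a k) := fun k hk hne =>
    g.setNode_node_ne v fun h => hne (hm.inj k hk (G.sw + 1) (by omega) h)
  have htn : ∀ k ≤ G.m, ((g.setNode (G.a (G.sw + 1)) v).node (G.a k)).type =
        (g.node (G.a k)).type ∧ ((g.setNode (G.a (G.sw + 1)) v).node (G.a k)).next =
        (g.node (G.a k)).next := by
    intro k hk
    rcases eq_or_ne k (G.sw + 1) with rfl | hne
    · rwa [Shared.setNode_node_self]
    · rw [hnode k hk hne]
      exact ⟨rfl, rfl⟩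
  refine {
    mem := {
      hm with
      hd_le := hhd.le.trans (Nat.le_succ _)
      sw_le_hd := by simp [Ghost.swapStep, hhd]
      sw_le := hsw
      next := fun k hk => ((htn k hk.le).2).trans (hm.next k hk)
      last := ((htn G.m le_rfl).2).trans hm.last
      type := fun k hk => ((htn k hk).1).trans (hm.type k hk)
      item := fun k hk hkm => by
        have hk : G.sw + 1 ≤ k := hk
        refine (congrArg Node.item (hnode (k + 1) hkm (by omega))).trans
          (hm.item k (by omega) hkm)
      app := fun u k hu => ?_
      swp := fun u k hu => ?_ }
    block := fun k hk => ?_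
    blockWrites := fun k hk => ?_
    idle := hI.idle_update hrole'
    thread := hI.thread_update (fun u hu => {
      m := le_rfl
      tl := le_rfl
      hd := le_rfl
      sw := Nat.le_succ _
      a := fun _ _ => rfl
      ty := fun _ _ => rfl
      val := fun _ _ => rfl
      S := fun k hk => Function.update_of_ne hk.ne _ _
      role := hrole' u hu
      pre := fun i o h => ⟨(hrole' u hu).trans h.role, h.own, h.lt, h.ne,
        (g.setNode_node_ne v (h.ne _ (by omega)).symm).trans h.node⟩ }) hok
    hist := hI.hist.step hth (fun _ => nofun) (Nat.le_succ _)
      (fun k hk => ⟨Function.update_of_ne hk.ne _ _, Function.update_of_ne hk.ne _ _⟩)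
      (fun k hk u hu => ?_) (fun k hk hk' => ?_) (fun _ => nofun)
    writes := ?_ }
  · have hut : u ≠ t := by
      rintro rfl
      simp [hself] at hu
    exact hm.app u k ((hrole' u hut).symm.trans hu)
  · rcases eq_or_ne u t with rfl | hut
    · obtain rfl : G.sw = k := by simpa [hself] using hu
      exact Nat.lt_succ_self _
    · exact (hm.swp u k ((hrole' u hut).symm.trans hu)).trans (Nat.lt_succ_self _)
  · rcases eq_or_ne k G.sw with rfl | hne
    · exact hblock
    · refine (hI.block k hk).ext (by simp only [Ghost.swapStep]; omega)
        (fun u hu => hrole' u (hnt u hu)) rfl rfl (Function.update_of_ne hne _ _) fun _ => ?_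
      exact congrArg Node.item (hnode (k + 1) hk (by omega))
  · obtain ⟨h₁, h₂⟩ := hI.blockWrites k hk
    have hold : ∀ x ∈ G.W k, x.2.TailSide →
        (∀ j, (G.swapStep t s τ.length).role x.1 = .app j → k ≤ j) ∧
        ((G.swapStep t s τ.length).role x.1 = .app k ∨
          (∃ i, env x.1 = some i ∧ G.ty k = tyOf i) ∨ k ≤ G.hd) := by
      intro x hx hx'
      obtain ⟨h₃, h₄⟩ := h₂ x hx hx'
      rcases eq_or_ne x.1 t with hxt | hxt
      · rw [hxt, hself]
        -- The thread was free, so its earlier tail-side writes were helping ones; their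
        -- justification does not depend on its role.
        rw [hxt, hrole] at h₄
        exact ⟨fun j => nofun, .inr (hxt ▸ h₄.resolve_left nofun)⟩
      · rw [hrole' _ hxt]
        exact ⟨h₃, h₄⟩
    rcases eq_or_ne k G.sw with rfl | hk'
    · refine ⟨?_, fun x hx hx' => ?_⟩
      · simp only [Ghost.swapStep, Function.update_self, List.map_append, h₁]
        simp [letters, hhd]
      · simp only [Ghost.swapStep, Function.update_self, List.mem_append,
          List.mem_singleton] at hx
        rcases hx with hx | rfl
        · exact hold x hx hx'
        · exact absurd hx' (by cases G.ty (G.sw + 1) <;> exact id)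
    · refine ⟨?_, fun x hx hx' => ?_⟩
      · simp only [Ghost.swapStep, Function.update_of_ne hk', h₁, letters,
          show (k < G.sw + 1 ↔ k < G.sw) by omega]
        congr!
      · simp only [Ghost.swapStep, Function.update_of_ne hk'] at hx
        exact hold x hx hx'
  · rcases eq_or_ne u t with rfl | hut
    · rw [hself] at hu
      simp only [reduceCtorEq, Role.swp.injEq, false_or] at hu
      omega
    · rwa [hrole' u hut] at hu
  · obtain rfl : k = G.sw := Nat.le_antisymm (Nat.lt_succ_iff.1 hk') hk
    -- A thread that has returned has its role in a block before `sw`, so it cannot be a participant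
    -- of the block exchanged now.
    refine ⟨Function.update_self .., fun u hu r hur => ?_⟩
    replace hur : (u, .ret r) ∈ τ := by simpa using hur
    obtain ⟨i', j, hj, hmem⟩ := hI.hist.returned u r hur
    have hr := ((hI.block j (by omega)).role_of_mem hmem).1
    rw [hrole' u (hnt u (by rcases hr with h | h <;> simp [h]))] at hu
    rcases hu with hu | hu
    · rcases hr with hr | hr
      · have := hu.symm.trans hr
        simp only [Role.app.injEq] at this
        omega
      · exact nomatch hu.symm.trans hr
    · exact (hm.swp u _ hu).false
  · rw [writes_append_of_some hi hy]
    refine (exchanges_append_right hI.writes _).trans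
      (exchanges_insert G.W (t, _) (show G.sw < G.m by omega) fun j h₁ h₂ x hx => ?_)
    obtain ⟨h₃, h₄⟩ := hI.later_writes hi (by omega) (.inr ⟨fun j => by simp [hrole], by rwa [hhd]⟩)
      j (by omega) h₂ x hx
    exact ⟨h₃, h₄, by cases G.ty (G.sw + 1) <;> trivial⟩

/-! #### Appending a node -/

/-- The linearized operations when `t` has appended a node. -/
def appended (t : T) : QInv V → List (T × QInv V × Option V)
  | .enq v => [(t, .enq v, none)]
  | .deq => []

def Ghost.linkStep (G : Ghost V T) (t : T) (i : QInv V) (o : ℕ) : Ghost V T :=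
  { G with
    m := G.m + 1
    a := Function.update G.a (G.m + 1) o
    ty := Function.update G.ty (G.m + 1) (tyOf i)
    role := Function.update G.role t (.app G.m)
    val := Function.update G.val G.m (argOf i)
    W := Function.update G.W G.m [(t, appendLayer (tyOf i))]
    S := Function.update G.S G.m (appended t i) }

/-- The hypothesis `hty` keeps the types beyond the head equal: either the last node already has the
new type, or no node lies beyond the head. -/
theorem Inv.linkStep (hI : Inv env G τ g th) (hth : th t ≠ none) (hi : env t = some i)
    (hy : layerOf i ℓ = some (appendLayer (tyOf i))) (htl : G.tl = G.m)
    (hty : G.ty G.m = tyOf i ∨ G.m ≤ G.hd) {o : ℕ} (hp : Pre G g i t o)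
    (hok : ThreadOK env (G.linkStep t i o)
      (g.setNode (G.a G.m) { g.node (G.a G.m) with next := some o }) t l' r) :
    Inv env (G.linkStep t i o) (τ ++ [(t, ℓ)])
      (g.setNode (G.a G.m) { g.node (G.a G.m) with next := some o })
      (Function.update th t (some (l', r))) := by
  have hm := hI.mem
  have := hm.hd_le
  have := hm.sw_le
  obtain ⟨b, a, rfl⟩ := eq_arw_of_layerOf hy
  have hnt : ∀ u, G.role u ≠ .free → u ≠ t := by
    rintro u hu rfl
    exact hu hp.role
  have hrole' : ∀ u ≠ t, (G.linkStep t i o).role u = G.role u := fun u hu =>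
    Function.update_of_ne hu _ _
  have hself : (G.linkStep t i o).role t = .app G.m := Function.update_self ..
  have ha : ∀ k ≤ G.m, (G.linkStep t i o).a k = G.a k := fun k hk =>
    Function.update_of_ne (by omega) _ _
  have ha' : (G.linkStep t i o).a (G.m + 1) = o := Function.update_self ..
  have hty' : ∀ k ≤ G.m, (G.linkStep t i o).ty k = G.ty k := fun k hk =>
    Function.update_of_ne (by omega) _ _
  have hty'' : (G.linkStep t i o).ty (G.m + 1) = tyOf i := Function.update_self ..
  have hval : ∀ k < G.m, (G.linkStep t i o).val k = G.val k := fun k hk =>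
    Function.update_of_ne hk.ne _ _
  have hS : ∀ k < G.m, (G.linkStep t i o).S k = G.S k := fun k hk =>
    Function.update_of_ne hk.ne _ _
  have hW : ∀ k < G.m, (G.linkStep t i o).W k = G.W k := fun k hk =>
    Function.update_of_ne hk.ne _ _
  have hW' : (G.linkStep t i o).W G.m = [(t, appendLayer (tyOf i))] := Function.update_self ..
  set g' := g.setNode (G.a G.m) { g.node (G.a G.m) with next := some o } with hg'
  have hnode : ∀ p, p ≠ G.a G.m → g'.node p = g.node p := fun p hne => g.setNode_node_ne _ hne
  have hnodem : g'.node (G.a G.m) = { g.node (G.a G.m) with next := some o } :=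
    g.setNode_node_self _ _
  have hnodeo : g'.node o = ⟨argOf i, tyOf i, none⟩ :=
    (hnode o (hp.ne _ le_rfl).symm).trans hp.node
  have hit : ∀ k ≤ G.m, (g'.node (G.a k)).type = (g.node (G.a k)).type ∧
      (g'.node (G.a k)).item = (g.node (G.a k)).item := by
    intro k hk
    by_cases h : G.a k = G.a G.m
    · rw [h, hnodem]
      exact ⟨rfl, rfl⟩
    · rw [hnode _ h]
      exact ⟨rfl, rfl⟩
  have hmem : Mem (G.linkStep t i o) g' := {
    hd_le := hm.hd_le
    sw_le_hd := hm.sw_le_hd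
    sw_le := hm.sw_le
    tl_le := hm.tl_le.trans (Nat.le_succ _)
    le_tl := by simp [Ghost.linkStep, htl]
    head := hm.head.trans (ha _ (by omega)).symm
    tail := hm.tail.trans (ha _ (by omega)).symm
    lt_size := fun k hk => by
      rcases Nat.le_succ_iff.1 hk with hk | rfl
      · rw [ha k hk]
        exact hm.lt_size k hk
      · rw [Nat.succ_eq_add_one, ha']
        exact hp.lt
    inj := fun j hj k hk h => by
      rcases Nat.le_succ_iff.1 hj with hj | rfl <;> rcases Nat.le_succ_iff.1 hk with hk | rfl
      · rw [ha j hj, ha k hk] at h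
        exact hm.inj j hj k hk h
      · rw [ha j hj, Nat.succ_eq_add_one, ha'] at h
        exact absurd h (hp.ne j hj)
      · rw [ha k hk, Nat.succ_eq_add_one, ha'] at h
        exact absurd h.symm (hp.ne k hk)
      · rfl
    next := fun k hk => by
      rcases Nat.lt_succ_iff_lt_or_eq.1 hk with hk | rfl
      · rw [ha k hk.le, ha (k + 1) hk, hnode _ fun h => hk.ne (hm.inj k hk.le _ le_rfl h)]
        exact hm.next k hk
      · rw [ha _ le_rfl, ha', hnodem]
    last := by
      change (g'.node ((G.linkStep t i o).a (G.m + 1))).next = none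
      rw [ha', hnodeo]
    type := fun k hk => by
      rcases Nat.le_succ_iff.1 hk with hk | rfl
      · rw [ha k hk, hty' k hk, (hit k hk).1]
        exact hm.type k hk
      · rw [Nat.succ_eq_add_one, ha', hty'', hnodeo]
    same := fun j k hj hjm hk hkm => by
      have key : ∀ k, G.hd ≤ k → k < G.m → G.ty (k + 1) = tyOf i := by
        intro k hk hkm
        have h := hty.resolve_right (by omega)
        obtain ⟨m, hm'⟩ : ∃ m', G.m = m' + 1 := ⟨G.m - 1, by omega⟩
        rw [hm.same k m hk hkm (by omega) (by omega), ← h, hm']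
      have key' : ∀ k, G.hd ≤ k → k < G.m + 1 → (G.linkStep t i o).ty (k + 1) = tyOf i := by
        intro k hk hkm
        rcases Nat.lt_succ_iff_lt_or_eq.1 hkm with hkm | rfl
        · rw [hty' _ hkm, key k hk hkm]
        · exact hty''
      rw [key' j hj hjm, key' k hk hkm]
    item := fun k hk hkm => by
      rcases Nat.lt_succ_iff_lt_or_eq.1 hkm with hkm | rfl
      · rw [ha _ hkm, hval k hkm, (hit _ hkm).2]
        exact hm.item k hk hkm
      · rw [ha', hnodeo]
        exact (Function.update_self (f := G.val) G.m (argOf i)).symm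
    app := fun u k hu => by
      rcases eq_or_ne u t with rfl | hut
      · obtain rfl : G.m = k := by simpa [hself] using hu
        exact ⟨Nat.lt_succ_self _, ha'.symm ▸ hp.own⟩
      · rw [hrole' u hut] at hu
        obtain ⟨h₁, h₂⟩ := hm.app u k hu
        exact ⟨h₁.trans (Nat.lt_succ_self _), (ha _ h₁).symm ▸ h₂⟩
    swp := fun u k hu => by
      have hut : u ≠ t := by
        rintro rfl
        simp [hself] at hu
      exact hm.swp u k ((hrole' u hut).symm.trans hu) }
  refine {
    mem := hmem
    block := fun k hk => ?_
    blockWrites := fun k hk => ?_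
    idle := hI.idle_update hrole'
    thread := hI.thread_update (fun u hu => {
      m := Nat.le_succ _
      tl := le_rfl
      hd := le_rfl
      sw := le_rfl
      a := ha
      ty := hty'
      val := hval
      S := fun k hk => hS k (by omega)
      role := hrole' u hu
      pre := fun i' o' h => ⟨(hrole' u hu).trans h.role, h.own, h.lt, fun k hk => by
        rcases Nat.le_succ_iff.1 hk with hk | rfl
        · rw [ha k hk]
          exact h.ne k hk
        · rw [Nat.succ_eq_add_one, ha']
          rintro rfl
          -- Two threads never hold the same private node, because `own` names only one of them.
          exact hu (Option.some.inj (h.own.symm.trans hp.own)),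
        (hnode _ (h.ne _ le_rfl).symm).trans h.node⟩ }) hok
    hist := hI.hist.step_of_sw_eq hth (fun _ => nofun) rfl (fun k hk => hS k (by omega)) rfl
      (fun k hk u hu => ?_) (fun _ => nofun)
    writes := ?_ }
  · rcases Nat.lt_succ_iff_lt_or_eq.1 hk with hk | rfl
    · refine (hI.block k hk).ext Iff.rfl (fun u hu => hrole' u (hnt u hu)) (hty' _ hk) (hval k hk)
        (hS k hk) fun _ => ?_
      rw [ha _ hk]
      exact (hit _ hk).2
    · have hval' : (G.linkStep t i o).val G.m = argOf i := Function.update_self ..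
      have hS' : (G.linkStep t i o).S G.m = appended t i := Function.update_self ..
      cases i with
      | enq v => exact .item t v (hm.sw_le.trans hm.tl_le) hself hi hty'' hval' hS'
      | deq => exact .reservation t (hm.sw_le.trans hm.tl_le) hself hi hty'' hval' hS'
  · rcases Nat.lt_succ_iff_lt_or_eq.1 hk with hk | rfl
    · obtain ⟨h₁, h₂⟩ := hI.blockWrites k hk
      refine ⟨?_, ?_⟩
      · rw [hW k hk, hty' _ hk]
        exact h₁
      · rw [hW k hk, hty' _ hk.le]
        intro x hx hx'
        obtain ⟨h₃, h₄⟩ := h₂ x hx hx'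
        rcases eq_or_ne x.1 t with hxt | hxt
        · rw [hxt, hself]
          rw [hxt, hp.role] at h₄
          -- Help given before the append lies in blocks before the own block `m`.
          refine ⟨fun j hj => ?_, .inr (hxt ▸ h₄.resolve_left nofun)⟩
          obtain rfl : G.m = j := by simpa using hj
          exact hk.le
        · rw [hrole' _ hxt]
          exact ⟨h₃, h₄⟩
    · refine ⟨?_, ?_⟩
      · rw [hW', hty'']
        change _ = letters _ G.tl G.sw G.hd G.m
        simp [letters, htl, hm.sw_le.trans hm.tl_le, hm.hd_le.trans (hm.sw_le.trans hm.tl_le)]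
      · rw [hW']
        intro x hx _
        obtain rfl := List.mem_singleton.1 hx
        exact ⟨fun j hj => by simpa [hself] using Eq.le (by simpa [hself] using hj), .inl hself⟩
  · have hut : u ≠ t := by
      rintro rfl
      rw [hself] at hu
      simp only [reduceCtorEq, Role.app.injEq, or_false] at hu
      omega
    rwa [hrole' u hut] at hu
  · rw [writes_append_of_some hi hy]
    have : (List.range (G.linkStep t i o).m).flatMap (G.linkStep t i o).W =
        (List.range G.m).flatMap G.W ++ [(t, appendLayer (tyOf i))] := by
      change (List.range (G.m + 1)).flatMap _ = _
      rw [List.range_succ, List.flatMap_append, List.flatMap_singleton, hW']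
      congr 1
      exact List.flatMap_congr fun k hk => hW k (List.mem_range.1 hk)
    rw [this]
    exact exchanges_append_right hI.writes _

end Steps

/-! ### Preservation of the invariant by every move. -/

section Moves

variable {env : T → Option (QInv V)} {G : Ghost V T} {g g' : Shared V} {i : QInv V} {t : T}
  {l l' : Loc V} {pc pc' : PC} {k : ℕ}
  {τ : List (T × Label (QInv V) (Option V) Act Tst)} {ℓ : Label (QInv V) (Option V) Act Tst}
  {th : T → Option (Loc V × Option (Kat Act Tst))} {r : Option (Kat Act Tst)}

theorem Mem.eq_hd (hm : Mem G g) (hk : k ≤ G.m) (h : g.head = G.a k) : k = G.hd :=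
  hm.inj k hk G.hd (hm.hd_le.trans (hm.sw_le.trans hm.tl_le)) (h.symm.trans hm.head)

theorem Mem.eq_tl (hm : Mem G g) (hk : k ≤ G.m) (h : g.tail = G.a k) : k = G.tl :=
  hm.inj k hk G.tl hm.tl_le (h.symm.trans hm.tail)

variable [DecidableEq T]

theorem Inv.tailToOffer (hI : Inv env G τ g th) (hth : th t ≠ none) (hi : env t = some i)
    (harg : l.arg = argOf i) (hx : i ≠ .deq → l.x = none) (ha : At G g i t l .linked)
    (h : g.tail = l.t) (b : Tst) :
    Inv env (G.tailStep t) (τ ++ [(t, .arw b .tailToOffer)]) { g with tail := l.offer }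
      (Function.update th t (some (l, PC.wait.code i))) := by
  obtain ⟨k, h₁, h₂, h₃, h₄, h₅⟩ := ha
  obtain rfl := hI.mem.eq_tl h₁.le (h.trans h₄)
  rw [h₃]
  refine hI.tailStep hth hi (by cases i <;> rfl) h₁ ⟨fun j hj => ?_, .inl h₂⟩
    ⟨i, .wait, hi, rfl, harg, hx, G.tl, Nat.lt_succ_self _, h₂, h₃⟩
  have := h₂.symm.trans hj
  simp only [Role.app.injEq] at this
  exact this.le

theorem Inv.swappedHead (hI : Inv env G τ g th) (hth : th t ≠ none) (hi : env t = some i)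
    (harg : l.arg = argOf i) (hx : i ≠ .deq → l.x = none) (ha : At G g i t l .swapped)
    (h : g.head = l.h) (b : Tst) :
    Inv env (G.headStep t) (τ ++ [(t, .arw b .headToN)]) { g with head := addr l.n }
      (Function.update th t (some (l, PC.atRet.code i))) := by
  have hm := hI.mem
  have := hm.sw_le
  have := hm.tl_le
  obtain ⟨k, h₁, h₂, h₃, h₄, h₅, h₆⟩ := ha
  obtain rfl := hm.eq_hd (by omega) (h.trans h₃)
  rw [h₄, addr, Option.getD_some]
  exact hI.headStep hth hi (by cases i <;> rfl) h₁ (.inr ⟨fun j => by simp [h₂], h₅⟩)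
    ⟨i, .atRet, hi, rfl, harg, hx, G.hd, h₁, h₆, .inr ⟨h₂, Nat.lt_succ_self _⟩⟩

theorem Inv.headToOffer (hI : Inv env G τ g th) (hth : th t ≠ none) (hi : env t = some i)
    (harg : l.arg = argOf i) (hx : i ≠ .deq → l.x = none) (ha : At G g i t l .headCas)
    (h : g.head = l.h) (b : Tst) :
    Inv env (G.headStep t) (τ ++ [(t, .arw b .headToOffer)]) { g with head := l.offer }
      (Function.update th t (some (l, PC.finish.code i))) := by
  have hm := hI.mem
  have := hm.sw_le
  have := hm.tl_le
  obtain ⟨k, h₁, h₂, h₃, h₄⟩ := ha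
  obtain rfl := hm.eq_hd (by omega) (h.trans h₄)
  rw [h₃]
  exact hI.headStep hth hi (by cases i <;> rfl) h₁ (.inl h₂)
    ⟨i, .finish, hi, rfl, harg, hx, G.hd, h₁, h₂, h₃⟩

theorem Inv.missedHead (hI : Inv env G τ g th) (hth : th t ≠ none) (hi : env t = some i)
    (harg : l.arg = argOf i) (hx : i ≠ .deq → l.x = none) (ha : At G g i t l .missed)
    (h : g.head = l.h) (b : Tst) :
    Inv env (G.headStep t) (τ ++ [(t, .arw b .headToN)]) { g with head := addr l.n }
      (Function.update th t (some (l, PC.loop.code i))) := by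
  have hm := hI.mem
  have := hm.sw_le
  have := hm.tl_le
  obtain ⟨hp, q, h₁, h₂, h₃, h₄, h₅⟩ := ha
  obtain rfl := hm.eq_hd (by omega) (h.trans h₂)
  rw [h₅, addr, Option.getD_some]
  exact hI.headStep hth hi (by cases i <;> rfl) h₃ (.inr ⟨fun j => by simp [hp.role], h₄⟩)
    ⟨i, .loop, hi, rfl, harg, hx, (Ext.headStep t).pre i _ hp⟩

theorem Inv.tailToN (hI : Inv env G τ g th) (hth : th t ≠ none) (hi : env t = some i)
    (harg : l.arg = argOf i) (hx : i ≠ .deq → l.x = none) (ha : At G g i t l .tailCas)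
    (h : g.tail = l.t) (b : Tst) :
    Inv env (G.tailStep t) (τ ++ [(t, .arw b .tailToN)]) { g with tail := addr l.n }
      (Function.update th t (some (l, PC.loop.code i))) := by
  obtain ⟨hp, p, h₁, h₂, h₃, h₄, h₅⟩ := ha
  obtain rfl := hI.mem.eq_tl h₄.le (h.trans h₂)
  rw [h₅, addr, Option.getD_some]
  exact hI.tailStep hth hi (by cases i <;> rfl) h₄
    ⟨fun j => by simp [hp.role], .inr (h₃.imp_left fun h => ⟨i, hi, h⟩)⟩
    ⟨i, .loop, hi, rfl, harg, hx, (Ext.tailStep t).pre i _ hp⟩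

/-- Only the last node has a null successor, so the successful CAS takes place at `a m`; as the node
read was not beyond the tail, the tail has also arrived there. -/
theorem Inv.link (hI : Inv env G τ g th) (hth : th t ≠ none) (hi : env t = some i)
    (harg : l.arg = argOf i) (hx : i ≠ .deq → l.x = none) (ha : At G g i t l .linkCas)
    (h : (g.node l.t).next = l.n) (b : Tst) :
    Inv env (G.linkStep t i l.offer) (τ ++ [(t, .arw b .linkOffer)])
      (g.setNode l.t { g.node l.t with next := some l.offer })
      (Function.update th t (some (l, PC.linked.code i))) := by
  have hm := hI.mem
  have := hm.tl_le
  obtain ⟨hp, p, h₁, h₂, h₃, h₄⟩ := ha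
  have htl : G.tl = G.m := by
    by_contra hne
    have := hm.next p (by omega)
    rw [← h₂, h, h₄] at this
    exact nomatch this
  obtain rfl : p = G.m := by
    by_contra hne
    have := hm.next p (by omega)
    rw [← h₂, h, h₄] at this
    exact nomatch this
  rw [h₂]
  refine hI.linkStep hth hi (by cases i <;> rfl) htl h₃ hp
    ⟨i, .linked, hi, rfl, harg, hx, G.m, Nat.lt_succ_self _, Function.update_self ..,
      (Function.update_self (f := G.a) ..).symm, ?_, htl.ge⟩
  exact h₂.trans (Function.update_of_ne (f := G.a) (Nat.lt_succ_self _).ne _).symm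

/-- A filled reservation is never null again, so a null item means that the block is not exchanged;
then `sw ≤ q ≤ hd ≤ sw` shows that it is the next one in line. -/
theorem Inv.put (hI : Inv env G τ g th) (hth : th t ≠ none) {v : V} (hi : env t = some (.enq v))
    (harg : l.arg = some v) (hx : l.x = none) (ha : At G g (.enq v) t l .swapReady)
    (h : (g.node (addr l.n)).item = none) (b : Tst) :
    ∃ G', Inv env G' (τ ++ [(t, .arw b .putArg)])
      (g.setNode (addr l.n) { g.node (addr l.n) with item := l.arg })
      (Function.update th t (some (l, PC.swapped.code (.enq v)))) := by
  have hm := hI.mem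
  have := hm.hd_le
  have := hm.sw_le
  have := hm.tl_le
  obtain ⟨hp, q, h₁, h₂, h₃, h₄, h₅⟩ := ha
  rw [h₅, addr, Option.getD_some] at h ⊢
  cases hI.block q (by omega) with
  | item _ _ _ _ _ h₆ => exact absurd h₆ h₄
  | taken _ _ _ _ _ _ _ _ h₆ => exact absurd h₆ h₄
  | filled _ _ _ _ _ _ _ _ _ _ h₆ => exact nomatch h.symm.trans h₆
  | reservation t₀ hsw h₆ h₇ h₈ h₉ h₁₀ =>
    obtain rfl : q = G.sw := by omega
    have hne : t₀ ≠ t := by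
      rintro rfl
      exact nomatch hp.role.symm.trans h₆
    refine ⟨G.swapStep t [(t, .enq v, none), (t₀, .deq, some v)] τ.length,
      hI.swapStep hth hi (by rw [h₈]; rfl) (by omega) h₃ hp.role h₄ ⟨rfl, rfl⟩ ?_ ?_⟩
    · exact .filled t₀ t v (Nat.lt_succ_self _) ((Function.update_of_ne hne _ _).trans h₆) h₇
        (Function.update_self ..) hi h₈ h₉
        ((congrArg Node.item (Shared.setNode_node_self ..)).trans harg) (Function.update_self ..)
    · refine ⟨.enq v, .swapped, hi, rfl, harg, fun _ => hx, G.sw, Nat.lt_succ_self _,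
        Function.update_self .., h₂, h₅, h₄, ?_⟩
      simp [Ghost.swapStep, hx]

/-- A taken item stays null, so finding the non-null value `x` means that the block is not
exchanged; as in `Inv.put`, it is then block `sw = hd`. -/
theorem Inv.take (hI : Inv env G τ g th) (hth : th t ≠ none) (hi : env t = some i)
    (harg : l.arg = argOf i) (hx : i ≠ .deq → l.x = none) (ha : At G g i t l .swapCas)
    (h : (g.node (addr l.n)).item = l.x) (b : Tst) :
    ∃ G', Inv env G' (τ ++ [(t, .arw b .putNull)])
      (g.setNode (addr l.n) { g.node (addr l.n) with item := none })
      (Function.update th t (some (l, PC.swapped.code i))) := by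
  have hm := hI.mem
  have := hm.hd_le
  have := hm.sw_le
  have := hm.tl_le
  obtain ⟨rfl, hp, q, h₁, h₂, h₃, h₄, h₅, hxn, hxv⟩ := ha
  rw [h₅, addr, Option.getD_some] at h ⊢
  cases hI.block q (by omega) with
  | reservation _ _ _ _ h₆ => exact absurd h₆ h₄
  | filled _ _ _ _ _ _ _ _ h₆ => exact absurd h₆ h₄
  | taken _ _ _ _ _ _ _ _ _ _ h₆ => exact absurd (h.symm.trans h₆) hxn
  | item t₀ v hsw h₆ h₇ h₈ h₉ h₁₀ =>
    obtain rfl : q = G.sw := by omega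
    have hne : t₀ ≠ t := by
      rintro rfl
      exact nomatch hp.role.symm.trans h₆
    refine ⟨G.swapStep t [(t₀, .enq v, none), (t, .deq, some v)] τ.length,
      hI.swapStep hth hi (by rw [h₈]; rfl) (by omega) h₃ hp.role h₄ ⟨rfl, rfl⟩ ?_ ?_⟩
    · exact .taken t₀ t v (Nat.lt_succ_self _) ((Function.update_of_ne hne _ _).trans h₆) h₇
        (Function.update_self ..) hi h₈ h₉
        (congrArg Node.item (Shared.setNode_node_self ..)) (Function.update_self ..)
    · refine ⟨.deq, .swapped, hi, rfl, harg, hx, G.sw, Nat.lt_succ_self _,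
        Function.update_self .., h₂, h₅, h₄, ?_⟩
      simp [Ghost.swapStep, hxv, h₉]

theorem Inv.move (hI : Inv env G τ g th) (hth : th t ≠ none) (hi : env t = some i)
    (harg : l.arg = argOf i) (hx : i ≠ .deq → l.x = none) (ha : At G g i t l pc)
    (h : Move i l g pc ℓ l' g' pc') :
    ∃ G', Inv env G' (τ ++ [(t, ℓ)]) g' (Function.update th t (some (l', pc'.code i))) := by
  cases h with
  | act a h | test b o h =>
    obtain ⟨h₁, h₂, h₃⟩ := h.at hI.mem hI.block hi harg hx ha
    exact ⟨G, hI.quiet hth hi (by cases i <;> rfl) (fun _ => nofun) (fun _ => nofun)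
      ⟨i, _, hi, rfl, h₁, h₂, h₃⟩⟩
  | alloc a =>
    refine ⟨G.alloc t g.size, hI.alloc hth hi a _ ⟨i, .loop, hi, rfl, harg, hx, ha,
      Function.update_self .., Nat.lt_succ_self _, fun k hk => (hI.mem.lt_size k hk).ne, ?_⟩⟩
    exact (Shared.setNode_node_self ..).trans (by rw [harg])
  | tailToN b h => exact ⟨_, hI.tailToN hth hi harg hx ha h b⟩
  | link b h => exact ⟨_, hI.link hth hi harg hx ha h b⟩
  | tailToOffer b h => exact ⟨_, hI.tailToOffer hth hi harg hx ha h b⟩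
  | headToOffer b h => exact ⟨_, hI.headToOffer hth hi harg hx ha h b⟩
  | put b v hv h =>
    subst hv
    exact hI.put hth hi harg (hx nofun) ha h b
  | take b h => exact hI.take hth hi harg hx ha h b
  | headToN b h => exact ⟨_, hI.swappedHead hth hi harg hx ha h b⟩
  | missedHead b h => exact ⟨_, hI.missedHead hth hi harg hx ha h b⟩
  | ret =>
    have ha' := ha
    obtain ⟨k, h₁, h₂, -⟩ := ha
    exact ⟨G, hI.quiet hth hi (by cases i <;> rfl) (fun _ => nofun)
      (fun r hr => ⟨i, k, h₁, by cases hr; exact h₂⟩) ⟨i, .returned, hi, rfl, harg, hx, ha'⟩⟩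
  | enqRet v hv =>
    subst hv
    have := hI.mem.sw_le
    have := hI.mem.tl_le
    obtain ⟨k, h₁, h₂, h₃⟩ := ha
    -- A waiting enqueue was woken by an exchange, so its block is one whose item has been taken.
    have hmem : (t, QInv.enq v, l.x) ∈ G.S k := by
      cases hI.block k (by omega) with
      | item | reservation => omega
      | taken t' _ v' _ h₄ h₅ _ _ _ _ _ h₆ =>
        obtain rfl := hI.mem.app_inj h₂ h₄
        obtain rfl : v = v' := by simpa using hi.symm.trans h₅
        simp [h₆, hx nofun]
      | filled t' _ _ _ h₄ h₅ =>
        obtain rfl := hI.mem.app_inj h₂ h₄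
        exact nomatch hi.symm.trans h₅
    exact ⟨G, hI.quiet hth hi rfl (fun _ => nofun)
      (fun r hr => ⟨_, k, h₁, by cases hr; exact hmem⟩)
      ⟨_, .returned, hi, rfl, harg, hx, k, h₁, hmem, .inl h₂⟩⟩

end Moves

/-- The history of the initial configuration. -/
def Ghost.init (V T : Type*) : Ghost V T where
  a _ := 0
  ty _ := .item
  m := 0
  tl := 0
  hd := 0
  sw := 0
  role _ := .free
  own _ := none
  val _ := none
  W _ := []
  S _ := []
  pos _ := 0

theorem Inv.init (env : T → Option (QInv V)) :
    Inv env (Ghost.init V T) [] (queue V).sharedInit fun _ => none where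
  mem := by
    constructor <;> simp [Ghost.init, queue]
  block := by simp [Ghost.init]
  blockWrites := by simp [Ghost.init]
  idle := by simp [Ghost.init]
  thread := by simp
  hist := by constructor <;> simp [Ghost.init]
  writes := .refl

theorem exists_inv [DecidableEq T] {env : T → Option (QInv V)}
    {τ : List (T × Label (QInv V) (Option V) Act Tst)}
    {C : Config T (Loc V) (Shared V) Act Tst} (h : (queue V).Exec env τ C) :
    ∃ G, Inv env G τ C.shared C.thread := by
  induction h with
  | init => exact ⟨_, Inv.init env⟩
  | inv t i _ hi ht ih =>
    obtain ⟨G, hI⟩ := ih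
    refine ⟨G, ?_⟩
    have := hI.invoke (l' := (queue V).localInit i) ht hi
      ⟨i, .start, hi, rfl, by cases i <;> rfl, by cases i <;> simp [queue], hI.idle t ht⟩
    rwa [show PC.start.code i = some ((queue V).code i) by rw [queue_code]; rfl] at this
  | step t _ ht hs ih =>
    obtain ⟨G, hI⟩ := ih
    obtain ⟨i, pc, hi, hk, harg, hx, ha⟩ := hI.thread t _ _ ht
    obtain ⟨pc', rfl, hmv⟩ := move_of_threadStep hk.symm hs
    exact hI.move (by simp [ht]) hi harg hx ha hmv

/-! ### Linearizations -/

theorem queueRun_of_forall_enq {q : List V} {w : List (QInv V × Option V)}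
    (h : ∀ x ∈ w, ∃ v, x = (.enq v, none)) : QueueRun q w := by
  induction w generalizing q with
  | nil => exact .nil q
  | cons x w ih =>
    obtain ⟨v, rfl⟩ := h x (by simp)
    exact .enq v (ih fun y hy => h y (by simp [hy]))

/-- Every pair starts from the empty queue and restores it. -/
theorem queueRun_flatMap_append {ι : Type*} {l : List ι} {f : ι → List (QInv V × Option V)}
    {w : List (QInv V × Option V)} (h : ∀ k ∈ l, ∃ v, f k = [(.enq v, none), (.deq, some v)])
    (hw : QueueRun [] w) : QueueRun [] (l.flatMap f ++ w) := by
  induction l with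
  | nil => exact hw
  | cons k l ih =>
    obtain ⟨v, hv⟩ := h k (by simp)
    rw [List.flatMap_cons, hv]
    exact .enq v (.deq v (ih fun j hj => h j (by simp [hj])))

section Linearization

variable {env : T → Option (QInv V)} {G : Ghost V T} {g : Shared V} {k : ℕ}
  {τ : List (T × Label (QInv V) (Option V) Act Tst)}
  {th : T → Option (Loc V × Option (Kat Act Tst))}

theorem Block.map_kind (hb : Block env G g k) (tl hd : ℕ) :
    (G.S k).map (fun x => kind x.2.1) =
      (letters (G.ty (k + 1)) tl G.sw hd k).flatMap marks := by
  cases hb with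
  | item t v h₁ _ _ h₂ _ h₃ | reservation t h₁ _ _ h₂ _ h₃ =>
    rw [h₂, h₃, letters, if_neg (not_lt.2 h₁)]
    split_ifs <;> rfl
  | taken t u v h₁ _ _ _ _ h₂ _ _ h₃ | filled t u v h₁ _ _ _ _ h₂ _ _ h₃ =>
    rw [h₂, h₃, letters, if_pos h₁]
    split_ifs <;> rfl

theorem Block.eq_of_lt (hb : Block env G g k) (hk : k < G.sw) :
    ∃ v, (G.S k).map Prod.snd = [(.enq v, none), (.deq, some v)] := by
  cases hb with
  | item | reservation => omega
  | taken _ _ v _ _ _ _ _ _ _ _ h | filled _ _ v _ _ _ _ _ _ _ _ h => exact ⟨v, by simp [h]⟩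

theorem Block.eq_of_ge (hb : Block env G g k) (hk : G.sw ≤ k) :
    ∀ x ∈ (G.S k).map Prod.snd, ∃ v, x = (.enq v, none) := by
  cases hb with
  | item _ _ _ _ _ _ _ h | reservation _ _ _ _ _ _ h => simp [h]
  | taken | filled => omega

theorem Block.nodup (hb : Block env G g k) : ((G.S k).map Prod.fst).Nodup := by
  cases hb with
  | item _ _ _ _ _ _ _ h | reservation _ _ _ _ _ _ h => simp [h]
  | taken t u _ _ h₁ _ h₂ _ _ _ _ h | filled t u _ _ h₁ _ h₂ _ _ _ _ h =>
    have : t ≠ u := by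
      rintro rfl
      exact nomatch h₁.symm.trans h₂
    simp [h, this, this.symm]

/-- The position of the linearization points of block `k`. -/
def Ghost.point (G : Ghost V T) (n k : ℕ) : ℕ := if k < G.sw then G.pos k else n - 1

/-- The linearization point of a thread. -/
def Ghost.threadPoint (G : Ghost V T) (n : ℕ) (t : T) : ℕ :=
  match G.role t with
  | .free => 0
  | .app k => G.point n k
  | .swp k => G.point n k

theorem Inv.isLinearization (hI : Inv env G τ g th) :
    IsLinearization (queueSpec V) τ ((List.range G.m).flatMap G.S) := by
  have hm := hI.mem
  have hsw : G.sw ≤ G.m := hm.sw_le.trans hm.tl_le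
  have hH := hI.hist
  have hrole : ∀ k < G.m, ∀ x ∈ G.S k, G.role x.1 = .app k ∨ G.role x.1 = .swp k := fun k hk x hx =>
    ((hI.block k hk).role_of_mem hx).1
  -- A thread has a single role and hence occurs in a single block.
  have huniq : ∀ j < G.m, ∀ k < G.m, ∀ x ∈ G.S j, ∀ y ∈ G.S k, x.1 = y.1 → j = k := by
    intro j hj k hk x hx y hy h
    have h₁ := hrole j hj x hx
    have h₂ := hrole k hk y hy
    rw [h] at h₁
    rcases h₁ with h₁ | h₁ <;> rcases h₂ with h₂ | h₂ <;> simpa using h₁.symm.trans h₂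
  have hpoint : ∀ k < G.m, ∀ x ∈ G.S k,
      G.threadPoint τ.length x.1 = G.point τ.length k := by
    intro k hk x hx
    rcases hrole k hk x hx with h | h <;> simp [Ghost.threadPoint, h]
  have hinv : ∀ k < G.m, ∀ x ∈ G.S k, (x.1, Label.inv x.2.1) ∈ τ := by
    intro k hk x hx
    refine hH.invoked x.1 (fun h => ?_) _ ((hI.block k hk).role_of_mem hx).2
    have := hI.idle x.1 h
    rcases hrole k hk x hx with h | h <;> exact nomatch this.symm.trans h
  have hmono : ∀ j k, j ≤ k → k < G.m → G.point τ.length j ≤ G.point τ.length k := by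
    intro j k hjk hk
    simp only [Ghost.point]
    split_ifs with h₁ h₂
    · exact hH.mono j k hjk h₂
    · have := hH.pos_lt j h₁
      omega
    · omega
    · rfl
  constructor
  · rw [List.map_flatMap, List.nodup_flatMap]
    refine ⟨fun k hk => (hI.block k (List.mem_range.1 hk)).nodup, ?_⟩
    refine List.pairwise_lt_range.imp_of_mem fun {j k} hj hk hjk => ?_
    intro t ht ht'
    obtain ⟨x, hx, rfl⟩ := List.mem_map.1 ht
    obtain ⟨y, hy, hxy⟩ := List.mem_map.1 ht'
    exact hjk.ne (huniq j (List.mem_range.1 hj) k (List.mem_range.1 hk) x hx y hy hxy.symm)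
  · intro t r h
    obtain ⟨i, k, hk, h⟩ := hH.returned t r h
    exact ⟨i, List.mem_flatMap.2 ⟨k, List.mem_range.2 (hk.trans_le hsw), h⟩⟩
  · intro t i r h
    obtain ⟨k, hk, h⟩ := List.mem_flatMap.1 h
    exact hinv k (List.mem_range.1 hk) _ h
  · refine ⟨G.threadPoint τ.length, fun x hx => ?_, ?_⟩
    · obtain ⟨k, hk, hx⟩ := List.mem_flatMap.1 hx
      replace hk := List.mem_range.1 hk
      have hr := hrole k hk x hx
      rw [hpoint k hk x hx, Ghost.point]
      split_ifs with h
      · exact ⟨hH.pos_lt k h, hH.pos_inv k h _ hr, hH.pos_ret k h _ hr⟩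
      -- The block is not exchanged and its point is the last position of the trace. The operation
      -- appended its node after its invocation, and it has not returned since returned operations
      -- lie in exchanged blocks.
      · have hlt := hH.inv_lt x.1 (by rcases hr with hr | hr <;> simp [hr])
        refine ⟨Nat.sub_lt (List.length_pos_of_mem (hinv k hk x hx)) one_pos, fun j i hj => ?_,
          fun j r hj => ?_⟩
        · have := hlt j i hj
          omega
        · obtain ⟨i, k', hk', h'⟩ := hH.returned _ r (List.mem_of_getElem? hj)
          exact absurd (huniq k hk k' (hk'.trans_le hsw) x hx _ h' rfl ▸ hk') h
    · rw [List.pairwise_flatMap]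
      refine ⟨fun k hk => ?_, ?_⟩
      · replace hk := List.mem_range.1 hk
        refine List.pairwise_of_forall_mem_list fun x hx y hy => ?_
        rw [hpoint k hk x hx, hpoint k hk y hy]
      · refine List.pairwise_lt_range.imp_of_mem fun {j k} hj hk hjk x hx y hy => ?_
        replace hk := List.mem_range.1 hk
        rw [hpoint j (List.mem_range.1 hj) x hx, hpoint k hk y hy]
        exact hmono j k hjk.le hk
  · obtain ⟨d, hd⟩ := Nat.exists_eq_add_of_le hsw
    rw [List.map_flatMap, hd, List.range_add, List.flatMap_append]
    refine queueRun_flatMap_append (fun k hk => ?_) (queueRun_of_forall_enq fun x hx => ?_)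
    · replace hk := List.mem_range.1 hk
      exact (hI.block k (hk.trans_le hsw)).eq_of_lt hk
    · obtain ⟨k, hk, hx⟩ := List.mem_flatMap.1 hx
      obtain ⟨j, hj, rfl⟩ := List.mem_map.1 hk
      replace hj := List.mem_range.1 hj
      exact (hI.block _ (by omega)).eq_of_ge (by omega) x hx

theorem Inv.map_kind (hI : Inv env G τ g th) :
    ((List.range G.m).flatMap G.S).map (fun x => kind x.2.1) =
      (((List.range G.m).flatMap G.W).map Prod.snd).flatMap marks := by
  rw [List.map_flatMap, List.map_flatMap, List.flatMap_assoc]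
  refine List.flatMap_congr fun k hk => ?_
  replace hk := List.mem_range.1 hk
  rw [(hI.block k hk).map_kind G.tl G.hd, (hI.blockWrites k hk).letters]

theorem Inv.mem_layerExpr (hI : Inv env G τ g th) (htl : G.tl = G.m) (hhd : G.hd = G.sw) :
    ((List.range G.m).flatMap G.W).map Prod.snd ∈ layerExpr.matches' := by
  have : ((List.range G.m).flatMap G.W).map Prod.snd =
      (List.range G.m).flatMap fun k => letters (G.ty (k + 1)) G.m G.sw G.sw k := by
    rw [List.map_flatMap]
    refine List.flatMap_congr fun k hk => ?_
    rw [(hI.blockWrites k (List.mem_range.1 hk)).letters, htl, hhd]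
  rw [this]
  exact flatMap_letters_mem_layerExpr (ty := fun k => G.ty (k + 1))
    (hI.mem.sw_le.trans hI.mem.tl_le) (hhd ▸ hI.mem.same)

/-! ### Completing the pending writes -/

/-- The appender of block `tl` must be at `linked`: every other assertion gives it no append role,
or one in a block that the tail has already passed. -/
theorem Inv.exists_linked (hI : Inv env G τ g th) (h : G.tl < G.m) :
    ∃ t i l, th t = some (l, PC.linked.code i) ∧ env t = some i ∧ l.arg = argOf i ∧
      (i ≠ .deq → l.x = none) ∧ At G g i t l .linked ∧ g.tail = l.t := by
  have hm := hI.mem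
  have := hm.sw_le
  obtain ⟨t, ht⟩ : ∃ t, G.role t = .app G.tl := by
    cases hI.block G.tl h with
    | item t _ _ h | reservation t _ h | taken t _ _ _ h | filled t _ _ _ h => exact ⟨t, h⟩
  rcases hth : th t with _ | ⟨l, k⟩
  · exact nomatch (hI.idle t hth).symm.trans ht
  obtain ⟨i, pc, hi, rfl, harg, hx, ha⟩ := hI.thread t l k hth
  have hfree : ∀ o, ¬ Pre G g i t o := fun o hp => nomatch hp.role.symm.trans ht
  have happ : ∀ k, G.role t = .app k → k = G.tl := fun k hk => by simpa using hk.symm.trans ht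
  have hser : ¬ Served G i t l := by
    rintro ⟨k, h₁, -, h₂ | ⟨h₂, -⟩⟩
    · have := happ k h₂
      omega
    · exact nomatch h₂.symm.trans ht
  cases pc
  case linked =>
    obtain ⟨k, h₁, h₂, h₃, h₄, h₅⟩ := ha
    obtain rfl := happ k h₂
    exact ⟨t, i, l, hth, hi, harg, hx, ⟨_, h₁, h₂, h₃, h₄, h₅⟩, hm.tail.trans h₄.symm⟩
  case start => exact nomatch ha.symm.trans ht
  case loop => exact absurd ha (hfree _)
  case atRet | returned => exact absurd ha hser
  case wait | waiting | woken | finish | wokenHead | headCas =>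
    obtain ⟨k, h₁, h₂, -⟩ := ha
    have := happ k h₂
    omega
  case swapped =>
    obtain ⟨k, h₁, h₂, -⟩ := ha
    exact nomatch h₂.symm.trans ht
  case swapItem | swapCas => exact absurd ha.2.1 (hfree _)
  all_goals exact absurd ha.1 (hfree _)

/-- The exchanger of block `hd` must be at `swapped`: after leaving it, `Served` would say that the
head has passed this block. -/
theorem Inv.exists_swapped (hI : Inv env G τ g th) (h : G.hd < G.sw) :
    ∃ t i l, th t = some (l, PC.swapped.code i) ∧ env t = some i ∧ l.arg = argOf i ∧
      (i ≠ .deq → l.x = none) ∧ At G g i t l .swapped ∧ g.head = l.h := by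
  have hm := hI.mem
  have := hm.sw_le
  have := hm.tl_le
  obtain ⟨t, ht⟩ : ∃ t, G.role t = .swp G.hd := by
    cases hI.block G.hd (by omega) with
    | item | reservation => omega
    | taken _ t _ _ _ _ h | filled _ t _ _ _ _ h => exact ⟨t, h⟩
  rcases hth : th t with _ | ⟨l, k⟩
  · exact nomatch (hI.idle t hth).symm.trans ht
  obtain ⟨i, pc, hi, rfl, harg, hx, ha⟩ := hI.thread t l k hth
  have hfree : ∀ o, ¬ Pre G g i t o := fun o hp => nomatch hp.role.symm.trans ht
  have hser : ¬ Served G i t l := by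
    rintro ⟨k, h₁, -, h₂ | ⟨h₂, h₃⟩⟩
    · exact nomatch h₂.symm.trans ht
    · have : k = G.hd := by simpa using h₂.symm.trans ht
      omega
  cases pc
  case swapped =>
    obtain ⟨k, h₁, h₂, h₃, h₄⟩ := ha
    obtain rfl : k = G.hd := by simpa using h₂.symm.trans ht
    exact ⟨t, i, l, hth, hi, harg, hx, ⟨_, h₁, h₂, h₃, h₄⟩, hm.head.trans h₃.symm⟩
  case start => exact nomatch ha.symm.trans ht
  case loop => exact absurd ha (hfree _)
  case atRet | returned => exact absurd ha hser
  case linked | wait | waiting | woken | finish | wokenHead | headCas =>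
    obtain ⟨k, h₁, h₂, -⟩ := ha
    exact nomatch h₂.symm.trans ht
  case swapItem | swapCas => exact absurd ha.2.1 (hfree _)
  all_goals exact absurd ha.1 (hfree _)

end Linearization

/-! ### Executing the pending advances of tail and head. -/

section Completion

variable [DecidableEq T] {env : T → Option (QInv V)} {G : Ghost V T}
  {τ : List (T × Label (QInv V) (Option V) Act Tst)} {C : Config T (Loc V) (Shared V) Act Tst}

theorem exists_tail_complete (hC : (queue V).Exec env τ C) (hI : Inv env G τ C.shared C.thread) :
    ∃ τ' C' G', (queue V).Exec env (τ ++ τ') C' ∧ Inv env G' (τ ++ τ') C'.shared C'.thread ∧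
      τ'.length ≤ 1 ∧ (C.Final → τ' = [] ∧ C' = C) ∧ G'.tl = G'.m := by
  rcases hI.mem.tl_le.eq_or_lt with h | h
  · exact ⟨[], C, G, by simpa using hC, by simpa using hI, by simp, fun _ => ⟨rfl, rfl⟩, h⟩
  · obtain ⟨t, i, l, hth, hi, harg, hx, ha, htl⟩ := hI.exists_linked h
    refine ⟨[(t, .arw .tailIsT .tailToOffer)], _, _,
      -- The remaining code is `one`, which is skipped as nullable, followed by the CAS, whose
      -- successful branch is taken.
      .step t hC hth (.seqL (.seqR .one (.seqL (.plusL (.arw _ _ htl))))),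
      hI.tailToOffer (by simp [hth]) hi harg hx ha htl _, le_rfl, fun hF => ?_,
      le_antisymm h hI.mem.le_tl⟩
    exact nomatch hF t l _ hth

theorem exists_head_complete (hC : (queue V).Exec env τ C) (hI : Inv env G τ C.shared C.thread) :
    ∃ τ' C' G', (queue V).Exec env (τ ++ τ') C' ∧ Inv env G' (τ ++ τ') C'.shared C'.thread ∧
      τ'.length ≤ 1 ∧ (C.Final → τ' = []) ∧ G'.hd = G'.sw ∧ (G.tl = G.m → G'.tl = G'.m) := by
  rcases hI.mem.hd_le.eq_or_lt with h | h
  · exact ⟨[], C, G, by simpa using hC, by simpa using hI, by simp, fun _ => rfl, h, id⟩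
  · obtain ⟨t, i, l, hth, hi, harg, hx, ha, hhd⟩ := hI.exists_swapped h
    refine ⟨[(t, .arw .headIsH .headToN)], _, _,
      .step t hC hth (.seqL (.seqR .one (.seqL (.plusL (.arw _ _ hhd))))),
      hI.swappedHead (by simp [hth]) hi harg hx ha hhd _, le_rfl, fun hF => ?_,
      le_antisymm h hI.mem.sw_le_hd, id⟩
    exact nomatch hF t l _ hth

end Completion

end SLS

theorem mainTheorem9 (V T : Type*) [DecidableEq T] :
    (SLS.queue V).Linearizable (queueSpec V) T ∧
    (∀ w ∈ SLS.layerExpr.matches', w.flatMap SLS.marks ∈ SLS.pointExpr.matches') ∧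
    ∀ (env : T → Option (QInv V)) τ C, (SLS.queue V).Exec env τ C →
      ∃ τ' C', (SLS.queue V).Exec env (τ ++ τ') C' ∧ τ'.length ≤ 2 ∧ (C.Final → τ' = []) ∧
        ∃ w, Relation.ReflTransGen SLS.Exchange (SLS.writes env (τ ++ τ')) w ∧
          w.map Prod.snd ∈ SLS.layerExpr.matches' ∧
          ∃ s, IsLinearization (queueSpec V) (τ ++ τ') s ∧
            s.map (fun x => SLS.kind x.2.1) = (w.map Prod.snd).flatMap SLS.marks := by
  refine ⟨fun env τ C hC => ?_, fun w => SLS.flatMap_marks_mem_pointExpr, fun env τ C hC => ?_⟩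
  · obtain ⟨G, hI⟩ := SLS.exists_inv hC
    exact ⟨_, hI.isLinearization⟩
  · obtain ⟨G, hI⟩ := SLS.exists_inv hC
    obtain ⟨τ₁, C₁, G₁, hC₁, hI₁, hlen₁, hF₁, htl⟩ := SLS.exists_tail_complete hC hI
    obtain ⟨τ₂, C₂, G₂, hC₂, hI₂, hlen₂, hF₂, hhd, htl₂⟩ := SLS.exists_head_complete hC₁ hI₁
    rw [List.append_assoc] at hC₂ hI₂
    refine ⟨τ₁ ++ τ₂, C₂, hC₂, by rw [List.length_append]; omega, fun hF => ?_, _, hI₂.writes,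
      hI₂.mem_layerExpr (htl₂ htl) hhd, _, hI₂.isLinearization, hI₂.map_kind⟩
    -- From a final configuration the first completion adds nothing, so the second one also starts
    -- from a final configuration.
    obtain ⟨rfl, rfl⟩ := hF₁ hF
    exact hF₂ hF
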